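/- Let $n\ge 0$, let $Q$ be a quiver of type $\mathbb{A}_{n+2}$ with vertices $1,\dots,n+2$ in linear order (so for each $1\le a\le n+1$ there is exactly one arrow between $a$ and $a+1$, in either direction, and no other arrows), let $\Bbbk$ be a field, and let $\operatorname{rep}Q$ be the category of finite dimensional representations of $Q$ over $\Bbbk$. **Maximal almost rigid representations.** A representation $T$ is *almost rigid* if it has no repeated indecomposable direct summands and, for all indecomposable direct summands $A,B$ of $T$, either $\operatorname{Ext}^1(A,B)=0$, or $\operatorname{Ext}^1(A,B)$ is one-dimensional and generated by the class of a short exact sequence $0\to B\to E\to A\to 0$ with $E$ indecomposable. It is *maximal almost rigid* if it is almost rigid and $T\oplus M$ is not almost rigid for every nonzero representation $M$. Let $\mathrm{mar}(Q)$ be the set of isomorphism classes of maximal almost rigid representations. For $T_1,T_2\in\mathrm{mar}(Q)$ say that $T_1$ *is covered by* $T_2$ if $T_1\cong M_1\oplus R$ and $T_2\cong M_2\oplus R$ with $M_1,M_2$ indecomposable, and there is a non-split short exact sequence $0\to M_1\to E\oplus E'\to M_2\to 0$ with $E,E'$ indecomposable direct summands of $R$. Let $\le$ be the reflexive transitive closure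 of this relation. **The Cambrian lattice of $Q$.** Let $P(Q)$ be a convex $(n+3)$-gon in the plane with vertices $0,1,\dots,n+2$ drawn in this order from left to right, no vertex lying in the convex hull of the others, such that $0$ and $n+2$ lie on a horizontal line $L$ and, for $1\le a\le n+1$, the vertex $a$ lies above $L$ if the arrow between $a$ and $a+1$ is $a\to a+1$, and below $L$ if it is $a\leftarrow a+1$. A triangulation of $P(Q)$ is a maximal set of pairwise non-crossing line segments between vertices (boundary edges included). Say that a triangulation $\mathcal T_1$ is covered by $\mathcal T_2$ if $\mathcal T_1\setminus\{\gamma_1\}=\mathcal T_2\setminus\{\gamma_2\}$ for some $\gamma_1\in\mathcal T_1$, $\gamma_2\in\mathcal T_2$ with $\gamma_1\ne\gamma_2$ and the slope of $\gamma_1$ smaller than the slope of $\gamma_2$. The type $\mathbb{A}$ Cambrian lattice of $Q$ is the set of triangulations of $P(Q)$ ordered by the reflexive transitive closure of this relation. **Theorem.** The relation $\le$ is a partial order on $\mathrm{mar}(Q)$, its covering relation is exactly the relation "$T_1$ is covered by $T_2$" defined above, and the poset $\mathrm{mar}(Q)$ is isomorphic to the type $\mathbb{A}$ Cambrian lattice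 of $Q$. -/

import Mathlib

open CategoryTheory CategoryTheory.Limits

universe u

/-! ### Quivers of type `A` and their representations -/

/-- The vertex set of the quiver of type `A_{n+2}` with orientation `up`. The vertices
`1, …, n + 2`, in linear order, are the elements `0, …, n + 1` of `Fin (n + 2)`. -/
def TypeAQuiver {n : ℕ} (_up : Fin (n + 1) → Bool) : Type := Fin (n + 2)

/-- The arrows: for every `a` there is exactly one arrow between the neighbouring vertices `a` and
`a + 1`, which points from `a` to `a + 1` if `up a` holds and from `a + 1` to `a` otherwise. -/
inductive TypeAQuiver.Arrow {n : ℕ} (up : Fin (n + 1) → Bool) :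
    Fin (n + 2) → Fin (n + 2) → Type
  | right (a : Fin (n + 1)) (h : up a = true) : TypeAQuiver.Arrow up a.castSucc a.succ
  | left (a : Fin (n + 1)) (h : up a = false) : TypeAQuiver.Arrow up a.succ a.castSucc

instance TypeAQuiver.instQuiver {n : ℕ} (up : Fin (n + 1) → Bool) :
    Quiver (TypeAQuiver up) where
  Hom i j := TypeAQuiver.Arrow up i j

/-- The category `rep Q` of finite dimensional representations over `k` of a quiver of
type `A`: functors from the free category on the quiver. -/
abbrev TypeARep (k : Type u) [Field k] {n : ℕ} (up : Fin (n + 1) → Bool) : Type (u + 1) :=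
  Paths (TypeAQuiver up) ⥤ FGModuleCat.{u} k

/-- The groups `Ext` exist in `rep Q`. -/
instance TypeARep.instHasExt (k : Type u) [Field k] {n : ℕ} (up : Fin (n + 1) → Bool) :
    HasExt.{u + 1} (TypeARep k up) :=
  HasExt.standard _

section Mar

variable {k : Type u} [Field k] {n : ℕ} {up : Fin (n + 1) → Bool}

/-- `X` is (isomorphic to) a direct summand of `T`. -/
def TypeARep.IsSummand (X T : TypeARep k up) : Prop :=
  ∃ Y : TypeARep k up, Nonempty (T ≅ X ⊞ Y)

/-- `T` is basic: it has no repeated (indecomposable) direct summand. -/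
def TypeARep.IsBasic (T : TypeARep k up) : Prop :=
  ∀ X : TypeARep k up, Indecomposable X → ¬ TypeARep.IsSummand (X ⊞ X) T

/-- `Ext(A, B)` is one-dimensional and is generated by the class of a short exact sequence
`0 ⟶ B ⟶ E ⟶ A ⟶ 0` whose middle term is indecomposable. -/
def TypeARep.ExtGeneratedByIndecomposable (A B : TypeARep k up) : Prop :=
  Module.finrank k (Abelian.Ext A B 1) = 1 ∧
    ∃ (E : TypeARep k up) (f : B ⟶ E) (g : E ⟶ A) (w : f ≫ g = 0)
      (h : (ShortComplex.mk f g w).ShortExact),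
      Indecomposable E ∧ Submodule.span k {(h.extClass : Abelian.Ext A B 1)} = ⊤

/-- Almost rigid representations. -/
def TypeARep.IsAlmostRigid (T : TypeARep k up) : Prop :=
  TypeARep.IsBasic T ∧
    ∀ A B : TypeARep k up, Indecomposable A → Indecomposable B →
      TypeARep.IsSummand A T → TypeARep.IsSummand B T →
        Subsingleton (Abelian.Ext A B 1) ∨ TypeARep.ExtGeneratedByIndecomposable A B

/-- Maximal almost rigid representations. -/
def TypeARep.IsMaximalAlmostRigid (T : TypeARep k up) : Prop :=
  TypeARep.IsAlmostRigid T ∧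
    ∀ M : TypeARep k up, ¬ IsZero M → ¬ TypeARep.IsAlmostRigid (T ⊞ M)

variable (k up) in
/-- The set `mar(Q)` of isomorphism classes of maximal almost rigid representations. -/
def Mar : Type (u + 1) :=
  Quotient ((isIsomorphicSetoid (TypeARep k up)).comap
    (Subtype.val : {T : TypeARep k up // TypeARep.IsMaximalAlmostRigid T} → TypeARep k up))

/-- The isomorphism class of a maximal almost rigid representation. -/
def Mar.mk (T : TypeARep k up) (hT : TypeARep.IsMaximalAlmostRigid T) : Mar k up :=
  Quotient.mk _ ⟨T, hT⟩

/-- The relation `T₁` is covered by `T₂`, for representations: `T₁ ≅ M₁ ⊕ R` and `T₂ ≅ M₂ ⊕ R`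
with `M₁`, `M₂` indecomposable, and there is a non-split short exact sequence
`0 ⟶ M₁ ⟶ E ⊕ E' ⟶ M₂ ⟶ 0` with `E`, `E'` indecomposable summands of `R`. -/
def TypeARep.CoveredBy (T₁ T₂ : TypeARep k up) : Prop :=
  ∃ M₁ M₂ R E E' : TypeARep k up,
    Indecomposable M₁ ∧ Indecomposable M₂ ∧
    Nonempty (T₁ ≅ M₁ ⊞ R) ∧ Nonempty (T₂ ≅ M₂ ⊞ R) ∧
    Indecomposable E ∧ Indecomposable E' ∧
    TypeARep.IsSummand E R ∧ TypeARep.IsSummand E' R ∧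
    ∃ (f : M₁ ⟶ E ⊞ E') (g : E ⊞ E' ⟶ M₂) (w : f ≫ g = 0),
      (ShortComplex.mk f g w).ShortExact ∧ IsEmpty (ShortComplex.mk f g w).Splitting

/-- The relation `T₁` is covered by `T₂` on `mar(Q)`. -/
def Mar.CoveredBy (t₁ t₂ : Mar k up) : Prop :=
  ∃ (T₁ T₂ : TypeARep k up) (h₁ : TypeARep.IsMaximalAlmostRigid T₁)
    (h₂ : TypeARep.IsMaximalAlmostRigid T₂),
    t₁ = Mar.mk T₁ h₁ ∧ t₂ = Mar.mk T₂ h₂ ∧ TypeARep.CoveredBy T₁ T₂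

/-- The order on `mar(Q)` generated by the relation `Mar.CoveredBy`. -/
instance Mar.instPreorder : Preorder (Mar k up) where
  le := Relation.ReflTransGen Mar.CoveredBy
  le_refl _ := Relation.ReflTransGen.refl
  le_trans _ _ _ h h' := h.trans h'

end Mar

/-! ### The polygon of a quiver of type `A` and its triangulations -/

/-- A drawing in the plane of the convex `(n + 3)`-gon `P(Q)` with vertices `0, …, n + 2`. -/
structure PolygonDrawing {n : ℕ} (up : Fin (n + 1) → Bool) where
  /-- the position of each vertex -/
  pt : Fin (n + 3) → ℝ × ℝ
  /-- the vertices are drawn in order from left to right -/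
  strictMono_fst : StrictMono fun i => (pt i).1
  /-- the first and the last vertex lie on the same horizontal line -/
  snd_last : (pt (Fin.last (n + 2))).2 = (pt 0).2
  /-- the upper-barred vertices lie above that line -/
  above : ∀ a : Fin (n + 1), up a = true → (pt 0).2 < (pt a.castSucc.succ).2
  /-- the lower-barred vertices lie below that line -/
  below : ∀ a : Fin (n + 1), up a = false → (pt a.castSucc.succ).2 < (pt 0).2
  /-- the points are the vertices of a convex polygon: none lies in the convex hull of others -/
  convexIndependent : ConvexIndependent ℝ pt

section Polygon

variable {n : ℕ} {up : Fin (n + 1) → Bool}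

/-- The line segments (boundary edges and diagonals) between two vertices `i < j` of a polygon with
vertices `0, …, n + 2`. -/
abbrev PolygonSegment (n : ℕ) : Type :=
  {p : Fin (n + 3) × Fin (n + 3) // p.1 < p.2}

/-- The slope of the line segment between `i` and `j`. -/
noncomputable def PolygonDrawing.slope (P : PolygonDrawing up) (γ : PolygonSegment n) : ℝ :=
  ((P.pt γ.1.2).2 - (P.pt γ.1.1).2) / ((P.pt γ.1.2).1 - (P.pt γ.1.1).1)

/-- Two different line segments cross if they have a common interior point. -/
def PolygonDrawing.Cross (P : PolygonDrawing up) (γ δ : PolygonSegment n) : Prop :=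
  γ ≠ δ ∧
    (openSegment ℝ (P.pt γ.1.1) (P.pt γ.1.2) ∩ openSegment ℝ (P.pt δ.1.1) (P.pt δ.1.2)).Nonempty

/-- A set of pairwise non-crossing line segments. -/
def PolygonDrawing.Noncrossing (P : PolygonDrawing up) (S : Set (PolygonSegment n)) : Prop :=
  ∀ γ ∈ S, ∀ δ ∈ S, ¬ P.Cross γ δ

/-- The triangulations of the polygon, including the boundary edges: the maximal sets of pairwise
non-crossing line segments. -/
def PolygonDrawing.Triangulation (P : PolygonDrawing up) : Type :=
  {S : Set (PolygonSegment n) // Maximal P.Noncrossing S}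

/-- `T₁` is covered by `T₂` if `T₂` arises from `T₁` by replacing one line segment by another one of
larger slope. -/
def PolygonDrawing.Triangulation.CoveredBy {P : PolygonDrawing up}
    (T₁ T₂ : P.Triangulation) : Prop :=
  ∃ γ₁ ∈ T₁.1, ∃ γ₂ ∈ T₂.1, γ₁ ≠ γ₂ ∧ T₁.1 \ {γ₁} = T₂.1 \ {γ₂} ∧ P.slope γ₁ < P.slope γ₂

/-- The Cambrian lattice: the order on the set of triangulations generated by the covering
relation `PolygonDrawing.Triangulation.CoveredBy`. -/
instance PolygonDrawing.Triangulation.instPreorder (P : PolygonDrawing up) :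
    Preorder P.Triangulation where
  le := Relation.ReflTransGen PolygonDrawing.Triangulation.CoveredBy
  le_refl _ := Relation.ReflTransGen.refl
  le_trans _ _ _ h h' := h.trans h'

end Polygon

/-! The segment from `i` to `j` of the polygon is matched with the interval representation supported
at the `v` in `Fin (n + 2)` with `i ≤ v < j`. Its endomorphisms are scalars, and a round trip
through a different interval representation is zero. Every nonzero representation has an interval
representation as a retract (`exists_segmentRep_retract`), so these are all the indecomposables. A
basic representation is therefore the same thing, up to isomorphism, as a set of segments
(`nonempty_iso_of_segments_eq`, `exists_isBasic_segments_eq`).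

The heart of the proof reads `Ext¹` off the position of two segments `γ` and `δ`. If they cross and
`γ` has the smaller slope, exchanging their right ends gives two sides of the quadrilateral which
they span, and these sides are the middle term of a non-split sequence from `M_γ` to `M_δ`. No
extension of `M_δ` by `M_γ` has an indecomposable middle term, since the dimension at a common
vertex would be too large. If the segments meet end to end on the appropriate side of the polygon,
`Ext¹` is a line spanned by their concatenation. In all other cases `Ext¹` vanishes, because a
cocycle can be trivialised vertex by vertex from one end of the quiver to the other. Hence almost
rigid means pairwise noncrossing, and maximal almost rigid means triangulation.

Crossing is encoded by `CrossesUpward`, which uses only the order of the end points and the side of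
the base line on which they lie. Convexity of the polygon makes this agree with geometric crossing
and with the comparison of slopes (`cross_iff`, `slope_lt_of_crossesUpward`).

Both covering relations become `IsFlip`: a diagonal of a quadrilateral is replaced by the other,
steeper one. Maximality puts the sides of the quadrilateral into both triangulations, where they
supply `E` and `E'`. For the order, the invariant is that a segment which crosses upward some member
of a triangulation still does so after any upward flip (`IsFlip.exists_crossesUpward`). So a segment
common to both ends of an interval lies in all its members. This gives antisymmetry and shows that
nothing lies strictly between the two ends of a flip. -/

section

universe w v u'

variable {C : Type u'} [Category.{v} C] [Abelian C]

/-! ### Effaceability of extension classes -/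

open HomologicalComplex in
-- Since `K` vanishes in degree `1`, everything in degree `0` is a cycle. So `K.X 0` maps onto the
-- homology, which is `X`, and it also includes into `K` as a complex concentrated in degree `0`.
lemma CochainComplex.exists_epi_of_quasiIso_single {X : C} {K : CochainComplex C ℤ}
    [K.IsStrictlyLE 0] (π : K ⟶ (single C (ComplexShape.up ℤ) 0).obj X) [QuasiIso π] :
    ∃ (p : K.X 0 ⟶ X) (ι : (single C (ComplexShape.up ℤ) 0).obj (K.X 0) ⟶ K),
      Epi p ∧ ι ≫ π = (single C (ComplexShape.up ℤ) 0).map p := by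
  have hz := K.isZero_of_isStrictlyLE 0 1 (by simp)
  let ε := K.iCyclesIso 0 1 (by simp) (hz.eq_of_tgt _ _)
  let α := ε.inv ≫ K.homologyπ 0 ≫ homologyMap π 0 ≫ (singleObjHomologySelfIso _ _ _).hom
  have hα : π.f 0 = α ≫ (singleObjXSelf (ComplexShape.up ℤ) 0 X).inv := by
    rw [← cancel_epi ε.hom]
    dsimp [α, ε]
    rw [Category.assoc, Category.assoc, Category.assoc, Iso.hom_inv_id_assoc, iCyclesIso_hom,
      homologyπ_naturality_assoc, homologyπ_singleObjHomologySelfIso_hom_assoc,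
      ← singleObjCyclesSelfIso_inv_iCycles, Iso.hom_inv_id_assoc, ← cyclesMap_i]
  refine ⟨α, mkHomFromSingle (𝟙 _) (by
      rintro _ rfl
      exact (K.isZero_of_isStrictlyLE 0 _ (by simp)).eq_of_tgt _ _), ?_, ?_⟩
  · dsimp [α]
    infer_instance
  · apply from_single_hom_ext
    rw [comp_f, mkHomFromSingle_f, Category.assoc, Category.id_comp, hα, single_map_f_self]

open _root_.DerivedCategory in
-- Write the morphism as a fraction through a complex `K` in degrees at most `0` and restrict to
-- `K.X 0`. A chain map from degree `0` to a complex concentrated in degree `m < 0` is zero.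
lemma DerivedCategory.exists_epi_comp_eq_zero [HasDerivedCategory.{w} C] {X Y : C} {m : ℤ}
    (hm : m < 0) (f : Q.obj ((HomologicalComplex.single C (ComplexShape.up ℤ) 0).obj X) ⟶
      Q.obj ((HomologicalComplex.single C (ComplexShape.up ℤ) m).obj Y)) :
    ∃ (Z : C) (p : Z ⟶ X), Epi p ∧
      Q.map ((HomologicalComplex.single C (ComplexShape.up ℤ) 0).map p) ≫ f = 0 := by
  have : CochainComplex.IsStrictlyLE
      ((HomologicalComplex.single C (ComplexShape.up ℤ) 0).obj X) 0 :=
    inferInstanceAs (CochainComplex.IsStrictlyLE ((CochainComplex.singleFunctor C 0).obj X) 0)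
  obtain ⟨K, _, π, h, g, rfl⟩ := right_fac_of_isStrictlyLE f 0
  have h' := h
  rw [isIso_Q_map_iff_quasiIso] at h'
  obtain ⟨p, ι, hp, hι⟩ := CochainComplex.exists_epi_of_quasiIso_single π
  have hg : ι ≫ g = 0 := by
    apply HomologicalComplex.from_single_hom_ext
    exact (HomologicalComplex.isZero_single_obj_X _ _ _ _ (by lia)).eq_of_tgt _ _
  refine ⟨_, p, hp, ?_⟩
  rw [← hι, Q.map_comp, Category.assoc, IsIso.hom_inv_id_assoc, ← Q.map_comp, hg, Q.map_zero]

open _root_.DerivedCategory in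
/-- Positive degree extension classes are effaceable. -/
lemma CategoryTheory.Abelian.Ext.exists_epi_comp_eq_zero [HasExt.{w} C] {X Y : C} {n : ℕ}
    (e : Ext X Y (n + 1)) :
    ∃ (Z : C) (p : Z ⟶ X), Epi p ∧ (mk₀ p).comp e (zero_add _) = 0 := by
  let := HasDerivedCategory.standard C
  -- The shift of `Y` by `n + 1` is `Y` placed in the negative degree `-(n + 1)`.
  let s := ((singleFunctors C).shiftIso (n + 1) (-(n + 1)) 0 (by lia)).hom.app Y
  obtain ⟨Z, p, hp, h⟩ := DerivedCategory.exists_epi_comp_eq_zero (X := X) (Y := Y)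
    (m := -(n + 1)) (by lia) (e.hom ≫ s)
  refine ⟨Z, p, hp, ?_⟩
  have h' : ((singleFunctor C 0).map p ≫ e.hom) ≫ s = 0 := (Category.assoc _ _ _).trans h
  ext
  rw [comp_hom, mk₀_hom, ShiftedHom.mk₀_comp, zero_hom]
  rw [← cancel_mono s, Limits.zero_comp]
  exact h'

end

/-! ### Criteria for `Ext¹` in an abelian category -/

namespace CategoryTheory.Abelian.Ext

universe w v u'

variable {C : Type u'} [Category.{v} C] [Abelian C] [HasExt.{w} C]

/-- An epimorphism onto `X` which kills the class exhibits it as the image of a map from the kernel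
to `Y` under the connecting homomorphism. If that map extends, the class is zero. -/
lemma subsingleton_one_of_forall_extends (X Y : C)
    (H : ∀ (K Z : C) (f : K ⟶ Z) (g : Z ⟶ X) (w : f ≫ g = 0),
      (ShortComplex.mk f g w).ShortExact → ∀ h : K ⟶ Y, ∃ h' : Z ⟶ Y, f ≫ h' = h) :
    Subsingleton (Ext X Y 1) := by
  refine subsingleton_of_forall_eq 0 fun e ↦ ?_
  obtain ⟨Z, p, hp, he⟩ := exists_epi_comp_eq_zero (n := 0) e
  have hS : (ShortComplex.mk (kernel.ι p) p (kernel.condition p)).ShortExact :=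
    { exact := ShortComplex.exact_of_f_is_kernel _ (kernelIsKernel p) }
  obtain ⟨x, rfl⟩ := contravariant_sequence_exact₃ hS _ e he (n₀ := 0) rfl
  obtain ⟨h, rfl⟩ := mk₀_bijective _ _ |>.2 x
  obtain ⟨h', rfl⟩ := H _ _ _ _ _ hS h
  have := hS.extClass_comp_assoc (mk₀ h') (n' := 1) (h := rfl)
  rwa [mk₀_comp_mk₀] at this

/-- The class is the obstruction to extending the identity of `S.X₁` along `S.f`. -/
lemma nonempty_splitting_of_extClass_eq_zero {S : ShortComplex C} (hS : S.ShortExact)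
    (h : hS.extClass = 0) : Nonempty S.Splitting := by
  obtain ⟨x, hx⟩ := contravariant_sequence_exact₁ hS S.X₁ (mk₀ (𝟙 _)) (n₁ := 1) rfl
    (by rw [h, zero_comp])
  obtain ⟨r, rfl⟩ := mk₀_bijective _ _ |>.2 x
  rw [mk₀_comp_mk₀] at hx
  have := hS.epi_g
  exact ⟨ShortComplex.Splitting.ofExactOfRetraction S hS.exact r ((mk₀_bijective _ _).1 hx) this⟩

/-- As `Ext¹(X₂, X₁)` vanishes, the connecting map from `End X₁`, which consists of scalars, to
`Ext¹(X₃, X₁)` is onto, and it sends the identity to the nonzero class of `S`. -/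
lemma finrank_one_and_span_extClass {k : Type*} [Field k] [Linear k C] {S : ShortComplex C}
    (hS : S.ShortExact) (hsplit : IsEmpty S.Splitting) (hE : Subsingleton (Ext S.X₂ S.X₁ 1))
    (hEnd : ∀ f : S.X₁ ⟶ S.X₁, ∃ c : k, f = c • 𝟙 _) :
    Module.finrank k (Ext S.X₃ S.X₁ 1) = 1 ∧ Submodule.span k {hS.extClass} = ⊤ := by
  have hne : hS.extClass ≠ 0 := fun h ↦
    (nonempty_splitting_of_extClass_eq_zero hS h).elim hsplit.false
  have hgen : ∀ e : Ext S.X₃ S.X₁ 1, ∃ c : k, c • hS.extClass = e := fun e ↦ by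
    obtain ⟨x, rfl⟩ := contravariant_sequence_exact₃ hS _ e (Subsingleton.elim _ _) (n₀ := 0) rfl
    obtain ⟨f, rfl⟩ := mk₀_bijective _ _ |>.2 x
    obtain ⟨c, rfl⟩ := hEnd f
    refine ⟨c, ?_⟩
    rw [mk₀_smul, comp_smul, comp_mk₀_id]
  exact ⟨(finrank_eq_one_iff_of_nonzero' _ hne).2 hgen,
    Submodule.eq_top_iff'.2 fun e ↦ Submodule.mem_span_singleton.2 (hgen e)⟩

lemma subsingleton_of_iso {X X' Y Y' : C} (eX : X ≅ X') (eY : Y ≅ Y') (n : ℕ)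
    [Subsingleton (Ext X' Y' n)] : Subsingleton (Ext X Y n) := by
  refine subsingleton_of_forall_eq 0 fun e ↦ ?_
  have h : (mk₀ eX.inv).comp (e.comp (mk₀ eY.hom) (add_zero n)) (zero_add n) = 0 :=
    Subsingleton.elim _ _
  have h' := congrArg (fun x ↦ (mk₀ eX.hom).comp (x.comp (mk₀ eY.inv) (add_zero n)) (zero_add n)) h
  simpa using h'

end CategoryTheory.Abelian.Ext

/-! ### Retracts and indecomposable objects -/

namespace CategoryTheory

variable {C : Type*} [Category* C] [Abelian C]

/-- A retract in an abelian category is a direct summand. -/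
lemma exists_iso_biprod_of_retract {X T : C} (i : X ⟶ T) (r : T ⟶ X) (h : i ≫ r = 𝟙 X) :
    ∃ Y : C, Nonempty (T ≅ X ⊞ Y) := by
  have : IsSplitMono i := IsSplitMono.mk' ⟨r, h⟩
  let S := ShortComplex.mk i (cokernel.π i) (cokernel.condition i)
  have hS : S.Exact := ShortComplex.exact_of_g_is_cokernel _ (cokernelIsCokernel i)
  let s := ShortComplex.Splitting.ofExactOfRetraction S hS r h inferInstance
  exact ⟨_, ⟨s.isoBinaryBiproduct⟩⟩

lemma isIso_of_indecomposable_of_retract {X T : C} (hT : Indecomposable T) (hX : ¬ IsZero X)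
    (i : X ⟶ T) (r : T ⟶ X) (h : i ≫ r = 𝟙 X) : IsIso i := by
  have : IsSplitMono i := IsSplitMono.mk' ⟨r, h⟩
  let S := ShortComplex.mk i (cokernel.π i) (cokernel.condition i)
  have hS : S.Exact := ShortComplex.exact_of_g_is_cokernel _ (cokernelIsCokernel i)
  let s := ShortComplex.Splitting.ofExactOfRetraction S hS r h inferInstance
  have hz := (hT.2 _ _ s.isoBinaryBiproduct).resolve_left hX
  have : Epi i := (Preadditive.epi_iff_isZero_cokernel i).2 hz
  exact isIso_of_mono_of_epi i

/-- The projector onto the first factor of a decomposition is a scalar `c`. Restricted to the two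
factors, this forces `c = 1` on the first and `c = 0` on the second, so one of them vanishes. -/
lemma indecomposable_of_end {k : Type*} [Field k] [Linear k C] {X : C} (hX : ¬ IsZero X)
    (hEnd : ∀ f : X ⟶ X, ∃ c : k, f = c • 𝟙 _) : Indecomposable X := by
  refine ⟨hX, fun Y Z e ↦ ?_⟩
  obtain ⟨c, hc⟩ := hEnd (e.hom ≫ biprod.fst ≫ biprod.inl ≫ e.inv)
  have h1 : (biprod.fst ≫ biprod.inl : Y ⊞ Z ⟶ Y ⊞ Z) = c • 𝟙 _ := by
    have := congrArg (fun f ↦ e.inv ≫ f ≫ e.hom) hc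
    simpa using this
  have hY : 𝟙 Y = c • 𝟙 Y := by
    have := congrArg (fun f ↦ biprod.inl ≫ f ≫ biprod.fst) h1
    simpa using this
  have hZ : 0 = c • 𝟙 Z := by
    have := congrArg (fun f ↦ biprod.inr ≫ f ≫ biprod.snd) h1
    simpa using this
  by_cases hc0 : c = 0
  · left; rw [IsZero.iff_id_eq_zero, hY, hc0, zero_smul]
  · right; rw [IsZero.iff_id_eq_zero]
    exact ((smul_eq_zero.1 hZ.symm).resolve_left hc0)

end CategoryTheory

/-! ### Representations described vertex by vertex -/

namespace TypeARep

variable {k : Type u} [Field k] {n : ℕ} {up : Fin (n + 1) → Bool}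

/-- The vertex space of a representation. -/
def Space (V : TypeARep k up) (v : Fin (n + 2)) : Type u :=
  (V.obj (show Paths (TypeAQuiver up) from v) : FGModuleCat k).obj

variable (V W U : TypeARep k up)

noncomputable instance (v : Fin (n + 2)) : AddCommGroup (V.Space v) :=
  inferInstanceAs (AddCommGroup (V.obj (show Paths (TypeAQuiver up) from v)).obj)

noncomputable instance (v : Fin (n + 2)) : Module k (V.Space v) :=
  inferInstanceAs (Module k (V.obj (show Paths (TypeAQuiver up) from v)).obj)

instance (v : Fin (n + 2)) : FiniteDimensional k (V.Space v) :=
  inferInstanceAs (Module.Finite k (V.obj (show Paths (TypeAQuiver up) from v)))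

/-- An arrow of the quiver as a path. -/
def path {s t : Fin (n + 2)} (e : TypeAQuiver.Arrow up s t) :
    (show Paths (TypeAQuiver up) from s) ⟶ (show Paths (TypeAQuiver up) from t) :=
  Quiver.Hom.toPath (V := TypeAQuiver up) (a := s) (b := t) e

/-- The linear map of a representation at an arrow. -/
def arr {s t : Fin (n + 2)} (e : TypeAQuiver.Arrow up s t) : V.Space s →ₗ[k] V.Space t :=
  (V.map (path e)).hom.hom

variable {V W U}

/-- The components of a morphism of representations. -/
def app (f : V ⟶ W) (v : Fin (n + 2)) : V.Space v →ₗ[k] W.Space v :=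
  (NatTrans.app f (show Paths (TypeAQuiver up) from v)).hom.hom

lemma app_arr (f : V ⟶ W) {s t : Fin (n + 2)} (e : TypeAQuiver.Arrow up s t) (x : V.Space s) :
    app f t (V.arr e x) = W.arr e (app f s x) :=
  LinearMap.congr_fun (congrArg (fun g ↦ g.hom.hom) (f.naturality (path e))) x

lemma hom_ext {f g : V ⟶ W} (h : ∀ v x, app f v x = app g v x) : f = g :=
  NatTrans.ext (funext fun v ↦ FGModuleCat.hom_ext (LinearMap.ext (h v)))

@[simp] lemma app_id (v : Fin (n + 2)) (x : V.Space v) : app (𝟙 V) v x = x := rfl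

@[simp] lemma app_comp (f : V ⟶ W) (g : W ⟶ U) (v : Fin (n + 2)) (x : V.Space v) :
    app (f ≫ g) v x = app g v (app f v x) := rfl

@[simp] lemma app_zero (v : Fin (n + 2)) (x : V.Space v) : app (0 : V ⟶ W) v x = 0 := rfl

@[simp] lemma app_smul (c : k) (f : V ⟶ W) (v : Fin (n + 2)) (x : V.Space v) :
    app (c • f) v x = c • app f v x := rfl

/-- A morphism of representations is given by linear maps which commute with the arrows. -/
def ofApp (f : ∀ v, V.Space v →ₗ[k] W.Space v)
    (hf : ∀ (s t : Fin (n + 2)) (e : TypeAQuiver.Arrow up s t) (x : V.Space s),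
      f t (V.arr e x) = W.arr e (f s x)) : V ⟶ W where
  app v := ObjectProperty.homMk (ModuleCat.ofHom (f v))
  naturality {X Y} p := by
    induction p using Paths.induction_fixed_source with
    | id => rw [V.map_id, W.map_id, Category.id_comp, Category.comp_id]
    | comp p q ih =>
      have hq : V.map ((Paths.of (TypeAQuiver up)).map q) ≫
          ObjectProperty.homMk (ModuleCat.ofHom (f _)) =
          ObjectProperty.homMk (ModuleCat.ofHom (f _)) ≫
            W.map ((Paths.of (TypeAQuiver up)).map q) :=
        FGModuleCat.hom_ext (LinearMap.ext (hf _ _ q))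
      rw [V.map_comp, W.map_comp, Category.assoc, hq, ← Category.assoc, ih, Category.assoc]

@[simp] lemma app_ofApp (f : ∀ v, V.Space v →ₗ[k] W.Space v) (hf) (v : Fin (n + 2)) :
    app (ofApp f hf) v = f v := rfl

/-- The representation with given vertex spaces and linear maps at the arrows. -/
def ofSpaces (X : Fin (n + 2) → FGModuleCat.{u} k)
    (m : ∀ {s t : Fin (n + 2)}, TypeAQuiver.Arrow up s t → (X s →ₗ[k] X t)) : TypeARep k up :=
  Paths.lift (V := TypeAQuiver up)
    { obj := X
      map := fun {s t} e ↦ ObjectProperty.homMk (ModuleCat.ofHom (m (s := s) (t := t) e)) }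

lemma arr_ofSpaces (X : Fin (n + 2) → FGModuleCat.{u} k)
    (m : ∀ {s t : Fin (n + 2)}, TypeAQuiver.Arrow up s t → (X s →ₗ[k] X t))
    {s t : Fin (n + 2)} (e : TypeAQuiver.Arrow up s t) (x : X s) :
    (ofSpaces X m).arr e x = m e x := by
  have h := Paths.lift_toPath (V := TypeAQuiver up) (C := FGModuleCat.{u} k)
    { obj := X
      map := fun {s t} e ↦ ObjectProperty.homMk (ModuleCat.ofHom (m (s := s) (t := t) e)) } e
  exact LinearMap.congr_fun (congrArg (fun g ↦ g.hom.hom) h) x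

variable (k up) in
/-- Evaluation at a vertex, as a functor to modules. -/
abbrev evalModule (v : Fin (n + 2)) : TypeARep k up ⥤ ModuleCat.{u} k :=
  (evaluation (Paths (TypeAQuiver up)) (FGModuleCat.{u} k)).obj
      (show Paths (TypeAQuiver up) from v) ⋙
    forget₂ (FGModuleCat.{u} k) (ModuleCat.{u} k)

instance (v : Fin (n + 2)) : PreservesFiniteLimits (evalModule k up v) :=
  have : PreservesFiniteLimits
      ((evaluation (Paths (TypeAQuiver up)) (FGModuleCat.{u} k)).obj
        (show Paths (TypeAQuiver up) from v)) :=
    ⟨fun _ _ _ ↦ inferInstance⟩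
  comp_preservesFiniteLimits _ _

instance (v : Fin (n + 2)) : PreservesFiniteColimits (evalModule k up v) :=
  have : PreservesFiniteColimits
      ((evaluation (Paths (TypeAQuiver up)) (FGModuleCat.{u} k)).obj
        (show Paths (TypeAQuiver up) from v)) :=
    ⟨fun _ _ _ ↦ inferInstance⟩
  comp_preservesFiniteColimits _ _

section ShortExact

variable {f : V ⟶ W} {g : W ⟶ U} {w : f ≫ g = 0}

lemma injective_of_shortExact (h : (ShortComplex.mk f g w).ShortExact) (v : Fin (n + 2)) :
    Function.Injective (app f v) :=
  (h.map_of_exact (evalModule k up v)).moduleCat_injective_f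

lemma surjective_of_shortExact (h : (ShortComplex.mk f g w).ShortExact) (v : Fin (n + 2)) :
    Function.Surjective (app g v) :=
  (h.map_of_exact (evalModule k up v)).moduleCat_surjective_g

lemma exact_of_shortExact (h : (ShortComplex.mk f g w).ShortExact) (v : Fin (n + 2))
    (x : W.Space v) (hx : app g v x = 0) : ∃ y, app f v y = x :=
  (ShortComplex.moduleCat_exact_iff _).1 (h.map_of_exact (evalModule k up v)).exact x hx

lemma mono_of_injective (h : ∀ v, Function.Injective (app f v)) : Mono f :=
  ⟨fun a b hab ↦ hom_ext fun v x ↦ h v (by rw [← app_comp, hab, app_comp])⟩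

lemma epi_of_surjective (h : ∀ v, Function.Surjective (app f v)) : Epi f :=
  ⟨fun a b hab ↦ hom_ext fun v x ↦ by
    obtain ⟨y, rfl⟩ := h v x
    rw [← app_comp, hab, app_comp]⟩

/-- Evaluation at a vertex is exact, so it commutes with homology, and a representation which
vanishes at every vertex is zero. -/
lemma shortExact_of_app (hf : ∀ v, Function.Injective (app f v))
    (hg : ∀ v, Function.Surjective (app g v))
    (h : ∀ v (x : W.Space v), app g v x = 0 → ∃ y, app f v y = x) :
    (ShortComplex.mk f g w).ShortExact := by
  refine ShortComplex.ShortExact.mk' ?_ (mono_of_injective hf) (epi_of_surjective hg)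
  have key : ∀ v, ((ShortComplex.mk f g w).map (evalModule k up v)).Exact := fun v ↦
    (ShortComplex.moduleCat_exact_iff _).2 (h v)
  rw [ShortComplex.exact_iff_isZero_homology, Functor.isZero_iff]
  intro v
  have h1 := ((ShortComplex.mk f g w).map (evalModule k up v)).exact_iff_isZero_homology.1 (key v)
  have h2 := h1.of_iso ((ShortComplex.mk f g w).mapHomologyIso (evalModule k up v)).symm
  rw [IsZero.iff_id_eq_zero] at h2 ⊢
  exact (forget₂ (FGModuleCat.{u} k) (ModuleCat.{u} k)).map_injective h2

end ShortExact

lemma isZero_iff : IsZero V ↔ ∀ v (x : V.Space v), x = 0 := by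
  rw [IsZero.iff_id_eq_zero]
  exact ⟨fun h v x ↦ by rw [← app_id (V := V) v x, h, app_zero],
    fun h ↦ hom_ext fun v x ↦ by rw [app_id, app_zero, h v x]⟩

end TypeARep

/-! ### Interval representations and their morphisms -/

namespace TypeARep

variable {k : Type u} [Field k] {n : ℕ} {up : Fin (n + 1) → Bool}

section Interval

open Classical in
/-- The line `k` if `p` holds and `0` otherwise. -/
noncomputable def stalk (k : Type u) [Field k] (p : Prop) : Submodule k k := if p then ⊤ else ⊥

lemma mem_stalk {p : Prop} {c : k} : c ∈ stalk k p ↔ (¬ p → c = 0) := by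
  by_cases h : p <;> simp [stalk, h]

open Classical in
/-- The map between stalks which is the identity whenever possible. -/
noncomputable def stalkMap (p q : Prop) : stalk k p →ₗ[k] stalk k q where
  toFun x := ⟨if q then x else 0, mem_stalk.2 fun h ↦ by simp [h]⟩
  map_add' x y := by ext; by_cases h : q <;> simp [h]
  map_smul' c x := by ext; by_cases h : q <;> simp [h]

variable (k up) in
/-- The representation which is `k` at the vertices in `S`, with identity maps between them, and
`0` elsewhere. -/
noncomputable def thin (S : Fin (n + 2) → Prop) : TypeARep k up :=
  ofSpaces (fun v ↦ FGModuleCat.of k (stalk k (S v))) fun {s t} _ ↦ stalkMap (S s) (S t)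

variable {S S' : Fin (n + 2) → Prop} {V : TypeARep k up}

/-- The coordinate on the vertex spaces of a thin representation. -/
noncomputable def val (v : Fin (n + 2)) : (thin k up S).Space v →ₗ[k] k := (stalk k (S v)).subtype

lemma val_injective (v : Fin (n + 2)) : Function.Injective (val (k := k) (up := up) (S := S) v) :=
  Subtype.val_injective

lemma val_eq_zero {v : Fin (n + 2)} (h : ¬ S v) (x : (thin k up S).Space v) : val v x = 0 :=
  mem_stalk.1 x.2 h

lemma eq_zero_of_not {v : Fin (n + 2)} (h : ¬ S v) (x : (thin k up S).Space v) : x = 0 :=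
  val_injective v (by rw [val_eq_zero h, map_zero])

lemma exists_val {v : Fin (n + 2)} (c : k) (h : ¬ S v → c = 0) :
    ∃ x : (thin k up S).Space v, val v x = c :=
  ⟨(⟨c, mem_stalk.2 h⟩ : stalk k (S v)), rfl⟩

open Classical in
lemma val_arr {s t : Fin (n + 2)} (e : TypeAQuiver.Arrow up s t) (x : (thin k up S).Space s) :
    val t ((thin k up S).arr e x) = if S t then val s x else 0 :=
  congrArg (val t) (arr_ofSpaces _ _ e x)

lemma val_arr_of {s t : Fin (n + 2)} (e : TypeAQuiver.Arrow up s t) (x : (thin k up S).Space s)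
    (h : S t) : val t ((thin k up S).arr e x) = val s x := by
  rw [val_arr, if_pos h]

/-- Morphisms from a thin representation. -/
noncomputable def fromThin (x : ∀ v, V.Space v) (hx : ∀ v, ¬ S v → x v = 0)
    (h : ∀ (s t : Fin (n + 2)) (e : TypeAQuiver.Arrow up s t), S s → V.arr e (x s) = x t) :
    thin k up S ⟶ V :=
  ofApp (fun v ↦ (val v).smulRight (x v)) fun s t e c ↦ by
    rw [LinearMap.smulRight_apply, LinearMap.smulRight_apply, map_smul, val_arr]
    by_cases hs : S s
    · rw [h s t e hs]
      by_cases ht : S t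
      · rw [if_pos ht]
      · rw [hx t ht, smul_zero, smul_zero]
    · rw [val_eq_zero hs, ite_self, zero_smul, zero_smul]

lemma app_fromThin (x : ∀ v, V.Space v) (hx) (h) (v : Fin (n + 2)) (c : (thin k up S).Space v) :
    app (fromThin x hx h) v c = val v c • x v := rfl

open Classical in
/-- Morphisms to a thin representation. -/
noncomputable def toThin (ξ : ∀ v, V.Space v →ₗ[k] k) (hξ : ∀ v, ¬ S v → ξ v = 0)
    (h : ∀ (s t : Fin (n + 2)) (e : TypeAQuiver.Arrow up s t), S t → ξ t ∘ₗ V.arr e = ξ s) :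
    V ⟶ thin k up S :=
  ofApp (fun v ↦ ((ξ v).codRestrict (stalk k (S v)) fun x ↦ mem_stalk.2 fun hv ↦ by
      rw [hξ v hv, LinearMap.zero_apply] : V.Space v →ₗ[k] stalk k (S v))) fun s t e x ↦ by
    refine val_injective t ?_
    rw [val_arr]
    change ξ t (V.arr e x) = if S t then ξ s x else 0
    by_cases ht : S t
    · rw [if_pos ht, ← h s t e ht, LinearMap.comp_apply]
    · rw [if_neg ht, hξ t ht, LinearMap.zero_apply]

lemma val_app_toThin (ξ : ∀ v, V.Space v →ₗ[k] k) (hξ) (h) (v : Fin (n + 2)) (x : V.Space v) :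
    val v (app (toThin (S := S) ξ hξ h) v x) = ξ v x := rfl

open Classical in
/-- The morphism between thin representations which is the identity whenever possible. -/
noncomputable def thinMap (h : ∀ (s t : Fin (n + 2)) (_ : TypeAQuiver.Arrow up s t),
    S s → S' t → (S t ↔ S' s)) : thin k up S ⟶ thin k up S' :=
  toThin (fun v ↦ if S' v then val v else 0) (fun v hv ↦ if_neg hv) fun s t e ht ↦ by
    ext x
    rw [if_pos ht, LinearMap.comp_apply, val_arr]
    by_cases hs : S s
    · have := h s t e hs ht
      by_cases ht' : S t
      · rw [if_pos ht', if_pos (this.1 ht')]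
      · rw [if_neg ht', if_neg fun h ↦ ht' (this.2 h), LinearMap.zero_apply]
    · rw [eq_zero_of_not hs x]; simp

open Classical in
lemma val_app_thinMap (h) (v : Fin (n + 2)) (x : (thin k up S).Space v) :
    val v (app (thinMap (S' := S') h) v x) = if S' v then val v x else 0 := by
  rw [thinMap, val_app_toThin]
  split_ifs <;> rfl

/-- Consecutive vertices are joined by an arrow. -/
lemma arrow_cases (a : Fin (n + 1)) : (∃ _ : TypeAQuiver.Arrow up a.castSucc a.succ, up a = true) ∨
    (∃ _ : TypeAQuiver.Arrow up a.succ a.castSucc, up a = false) := by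
  cases h : up a
  · exact Or.inr ⟨.left a h, rfl⟩
  · exact Or.inl ⟨.right a h, rfl⟩

end Interval

/-- The indecomposable representation of a line segment of the polygon: the vertices of the quiver
in its support are those between the two end points. -/
noncomputable abbrev segmentRep (k : Type u) [Field k] {n : ℕ} (up : Fin (n + 1) → Bool)
    (γ : PolygonSegment n) : TypeARep k up :=
  thin k up fun v ↦ γ.1.1.val ≤ v.val ∧ v.val < γ.1.2.val

/-- The scalar is read off at the left end of the support and carried to the right one vertex at a
time. The arrows inside the support are identities in either direction. -/
lemma segmentRep_end (γ : PolygonSegment n) (f : segmentRep k up γ ⟶ segmentRep k up γ) :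
    ∃ c : k, f = c • 𝟙 _ := by
  obtain ⟨⟨i, j⟩, hij⟩ := γ
  have hij' : i.val < j.val := hij
  obtain ⟨x₀, hx₀⟩ := exists_val (k := k) (up := up)
    (S := fun v : Fin (n + 2) ↦ i.val ≤ v.val ∧ v.val < j.val) (v := ⟨i, by lia⟩) 1
    (fun h ↦ (h ⟨le_rfl, hij'⟩).elim)
  refine ⟨val _ (app f _ x₀), hom_ext fun v x ↦ val_injective v ?_⟩
  rw [app_smul, map_smul, app_id, smul_eq_mul]
  by_cases hv : i.val ≤ v.val ∧ v.val < j.val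
  swap
  · rw [val_eq_zero hv x, mul_zero]
    exact val_eq_zero hv _
  suffices H : ∀ m (hm : m < n + 2), i.val ≤ m → m < j.val →
      ∀ x, val ⟨m, hm⟩ (app f ⟨m, hm⟩ x) = val _ (app f _ x₀) * val ⟨m, hm⟩ x from
    H v.val v.2 hv.1 hv.2 x
  intro m hm hi
  induction m, hi using Nat.le_induction with
  | base =>
    intro _ x
    have : x = val _ x • x₀ := val_injective _ (by rw [map_smul, hx₀, smul_eq_mul, mul_one])
    conv_lhs => rw [this]
    rw [map_smul, map_smul, smul_eq_mul, mul_comm]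
  | succ m him ih =>
    intro hmj x
    have hs : i.val ≤ (Fin.castSucc (⟨m, by lia⟩ : Fin (n + 1))).val ∧
      (Fin.castSucc (⟨m, by lia⟩ : Fin (n + 1))).val < j.val := ⟨him, by simp; lia⟩
    have ht : i.val ≤ (Fin.succ (⟨m, by lia⟩ : Fin (n + 1))).val ∧
      (Fin.succ (⟨m, by lia⟩ : Fin (n + 1))).val < j.val := ⟨by simp; lia, by simpa using hmj⟩
    rcases arrow_cases (up := up) ⟨m, by lia⟩ with ⟨e, -⟩ | ⟨e, -⟩
    · obtain ⟨y, hy⟩ := exists_val (k := k) (up := up)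
        (S := fun v : Fin (n + 2) ↦ i.val ≤ v.val ∧ v.val < j.val) (v := ⟨m, by lia⟩) (val _ x)
        (fun h ↦ (h hs).elim)
      have hyx : (segmentRep k up ⟨(i, j), hij⟩).arr e y = x :=
        val_injective _ (by rw [val_arr_of _ _ ht]; exact hy)
      rw [← hyx]
      have := ih (by lia) (by lia) y
      have h2 := app_arr f e y
      refine (congrArg (val _) h2).trans ?_
      rw [val_arr_of _ _ ht]
      refine this.trans (congrArg _ ?_)
      exact (val_arr_of _ _ ht).symm
    · have := ih (by lia) (by lia) ((segmentRep k up ⟨(i, j), hij⟩).arr e x)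
      refine Eq.trans ?_ (this.trans (congrArg _ (val_arr_of e x hs)))
      refine Eq.trans ?_ (congrArg (val _) (app_arr f e x)).symm
      exact (val_arr_of _ _ hs).symm

lemma not_isZero_segmentRep (γ : PolygonSegment n) : ¬ IsZero (segmentRep k up γ) := by
  intro h
  have hγ : γ.1.1.val < γ.1.2.val := γ.2
  obtain ⟨x, hx⟩ := exists_val (k := k) (up := up)
    (S := fun v : Fin (n + 2) ↦ γ.1.1.val ≤ v.val ∧ v.val < γ.1.2.val)
    (v := ⟨γ.1.1, by lia⟩) 1 (fun h ↦ (h ⟨le_rfl, hγ⟩).elim)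
  rw [isZero_iff.1 h _ x, map_zero] at hx
  exact zero_ne_one hx

lemma indecomposable_segmentRep (γ : PolygonSegment n) : Indecomposable (segmentRep k up γ) :=
  indecomposable_of_end (k := k) (not_isZero_segmentRep γ) (segmentRep_end γ)

lemma segment_subset_of_comp_ne_zero {γ δ : PolygonSegment n}
    (f : segmentRep k up γ ⟶ segmentRep k up δ) (g : segmentRep k up δ ⟶ segmentRep k up γ)
    {c : k} (hc : c ≠ 0) (h : f ≫ g = c • 𝟙 _) : δ.1.1 ≤ γ.1.1 ∧ γ.1.2 ≤ δ.1.2 := by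
  have hγ : γ.1.1.val < γ.1.2.val := γ.2
  have key : ∀ v : Fin (n + 2), γ.1.1.val ≤ v.val ∧ v.val < γ.1.2.val →
      δ.1.1.val ≤ v.val ∧ v.val < δ.1.2.val := by
    intro v hv
    by_contra hv'
    obtain ⟨x, hx⟩ := exists_val (k := k) (up := up)
      (S := fun v : Fin (n + 2) ↦ γ.1.1.val ≤ v.val ∧ v.val < γ.1.2.val)
      (v := v) 1 (fun h ↦ (h hv).elim)
    have h1 : app (f ≫ g) v x = 0 := by
      rw [app_comp, eq_zero_of_not hv' (app f v x), map_zero]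
    rw [h, app_smul, app_id] at h1
    have := congrArg (val v) h1
    rw [map_smul, hx, map_zero, smul_eq_mul, mul_one] at this
    exact hc this
  have h1 := key ⟨γ.1.1, by lia⟩ ⟨le_rfl, hγ⟩
  have h2 := key ⟨γ.1.2 - 1, by lia⟩ ⟨by simp; lia, by simp; lia⟩
  simp only at h1 h2
  exact ⟨h1.1, Fin.le_def.2 (by lia)⟩

/-- Both round trips are scalars. If one is nonzero, comparing the two ways to bracket `f ≫ g ≫ f`
shows that they are equal. Then each support contains the other. -/
lemma segmentRep_comp_eq_zero {γ δ : PolygonSegment n} (hne : γ ≠ δ)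
    (f : segmentRep k up γ ⟶ segmentRep k up δ) (g : segmentRep k up δ ⟶ segmentRep k up γ) :
    f ≫ g = 0 := by
  obtain ⟨c, hc⟩ := segmentRep_end γ (f ≫ g)
  obtain ⟨d, hd⟩ := segmentRep_end δ (g ≫ f)
  by_cases h0 : c = 0
  · rw [hc, h0, zero_smul]
  have hcd : d = c := by
    have h1 : c • f = d • f := by
      have : (f ≫ g) ≫ f = f ≫ g ≫ f := Category.assoc _ _ _
      rwa [hc, hd, Linear.smul_comp, Linear.comp_smul, Category.id_comp, Category.comp_id] at this
    by_contra hne'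
    have : (c - d) • f = 0 := by rw [sub_smul, h1, sub_self]
    rcases smul_eq_zero.1 this with h | h
    · exact hne' (sub_eq_zero.1 h).symm
    · rw [h, zero_comp] at hc
      rcases smul_eq_zero.1 hc.symm with h | h
      · exact h0 h
      · exact not_isZero_segmentRep γ ((IsZero.iff_id_eq_zero _).2 h)
  have h1 := segment_subset_of_comp_ne_zero f g h0 hc
  have h2 := segment_subset_of_comp_ne_zero g f (hcd ▸ h0) hd
  exact absurd (Subtype.ext (Prod.ext (le_antisymm h2.1 h1.1) (le_antisymm h1.2 h2.2))) hne

end TypeARep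

/-! ### Interval representations are the only indecomposables -/

lemma LinearMap.exists_comp_eq_of_comap_le_ker {k V W : Type*} [Field k] [AddCommGroup V]
    [Module k V] [AddCommGroup W] [Module k W] (g : V →ₗ[k] W) (B : Submodule k W)
    (ξ : V →ₗ[k] k) (h : B.comap g ≤ LinearMap.ker ξ) :
    ∃ η : W →ₗ[k] k, η ∘ₗ g = ξ ∧ B ≤ LinearMap.ker η := by
  have hξ : ξ ∈ LinearMap.range (B.mkQ ∘ₗ g).dualMap := by
    rw [LinearMap.range_dualMap_eq_dualAnnihilator_ker, Submodule.mem_dualAnnihilator]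
    intro x hx
    rw [LinearMap.ker_comp, Submodule.ker_mkQ] at hx
    exact h hx
  obtain ⟨η, rfl⟩ := hξ
  refine ⟨η ∘ₗ B.mkQ, rfl, fun b hb ↦ ?_⟩
  rw [LinearMap.mem_ker, LinearMap.comp_apply, Submodule.mkQ_apply,
    (Submodule.Quotient.mk_eq_zero B).2 hb, map_zero]

lemma Submodule.exists_le_ker_apply_eq_one {k V : Type*} [Field k] [AddCommGroup V]
    [Module k V] (B : Submodule k V) {x : V} (hx : x ∉ B) :
    ∃ ξ : V →ₗ[k] k, B ≤ LinearMap.ker ξ ∧ ξ x = 1 := by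
  obtain ⟨ξ, h1, h2⟩ := B.exists_le_ker_of_notMem hx
  refine ⟨(ξ x)⁻¹ • ξ, fun b hb ↦ ?_, by simp [h1]⟩
  simp [LinearMap.mem_ker.1 (h2 hb)]

namespace TypeARep

variable {k : Type u} [Field k] {n : ℕ} {up : Fin (n + 1) → Bool}

lemma arrow_val {s t : Fin (n + 2)} (e : TypeAQuiver.Arrow up s t) :
    s.val + 1 = t.val ∨ t.val + 1 = s.val := by
  rcases e with ⟨a, -⟩ | ⟨a, -⟩ <;> simp

lemma up_eq_true_of_arrow {s t : Fin (n + 2)} (e : TypeAQuiver.Arrow up s t) (a : Fin (n + 1))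
    (hs : s = a.castSucc) (ht : t = a.succ) : up a = true := by
  rcases e with ⟨b, h⟩ | ⟨b, h⟩
  · rwa [← Fin.castSucc_injective _ hs]
  · simp [Fin.ext_iff] at hs ht; lia

lemma up_eq_false_of_arrow {s t : Fin (n + 2)} (e : TypeAQuiver.Arrow up s t) (a : Fin (n + 1))
    (hs : s = a.succ) (ht : t = a.castSucc) : up a = false := by
  rcases e with ⟨b, h⟩ | ⟨b, h⟩
  · simp [Fin.ext_iff] at hs ht; lia
  · rwa [← Fin.castSucc_injective _ ht]

/-- Heterogeneous equality keeps the end points of `e` variable, so that a case distinction on `e`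
is possible. -/
lemma arrow_heq_right {s t : Fin (n + 2)} (e : TypeAQuiver.Arrow up s t) (a : Fin (n + 1))
    (h : up a = true) (hs : s = a.castSucc) (ht : t = a.succ) :
    e ≍ TypeAQuiver.Arrow.right a h := by
  rcases e with ⟨b, _⟩ | ⟨b, _⟩
  · obtain rfl := Fin.castSucc_injective _ hs; rfl
  · simp [Fin.ext_iff] at hs ht; lia

lemma arrow_heq_left {s t : Fin (n + 2)} (e : TypeAQuiver.Arrow up s t) (a : Fin (n + 1))
    (h : up a = false) (hs : s = a.succ) (ht : t = a.castSucc) :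
    e ≍ TypeAQuiver.Arrow.left a h := by
  rcases e with ⟨b, _⟩ | ⟨b, _⟩
  · simp [Fin.ext_iff] at hs ht; lia
  · obtain rfl := Fin.castSucc_injective _ ht; rfl

instance {s t : Fin (n + 2)} : Subsingleton (TypeAQuiver.Arrow up s t) where
  allEq e e' := by
    rcases e with ⟨a, h⟩ | ⟨a, h⟩
    · exact (eq_of_heq (arrow_heq_right e' a h rfl rfl)).symm
    · exact (eq_of_heq (arrow_heq_left e' a h rfl rfl)).symm

/-- A segment starting at `v` which is a retract of the restriction of `V` to the vertices from
`v` on, with the vector at `v` in `A` and the functional at `v` vanishing on `B`. -/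
structure RightRetract (V : TypeARep k up) (v : Fin (n + 2)) (A B : Submodule k (V.Space v)) where
  finish : ℕ
  lt_finish : v.val < finish
  finish_le : finish ≤ n + 2
  vec : ∀ w, V.Space w
  form : ∀ w, V.Space w →ₗ[k] k
  vec_eq_zero : ∀ w, ¬ (v.val ≤ w.val ∧ w.val < finish) → vec w = 0
  form_eq_zero : ∀ w, ¬ (v.val ≤ w.val ∧ w.val < finish) → form w = 0
  arr_vec : ∀ (s t : Fin (n + 2)) (e : TypeAQuiver.Arrow up s t), v ≤ s → v ≤ t → s.val < finish →
    V.arr e (vec s) = vec t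
  form_arr : ∀ (s t : Fin (n + 2)) (e : TypeAQuiver.Arrow up s t), v ≤ s → v ≤ t → t.val < finish →
    form t ∘ₗ V.arr e = form s
  vec_mem : vec v ∈ A
  le_ker_form : B ≤ LinearMap.ker (form v)
  form_vec : ∀ w, v.val ≤ w.val → w.val < finish → form w (vec w) = 1

namespace RightRetract

variable {V : TypeARep k up}

open Classical in
/-- The retract supported at `v` only. -/
noncomputable def single {v : Fin (n + 2)} {A B : Submodule k (V.Space v)} (x : V.Space v)
    (ξ : V.Space v →ₗ[k] k) (hx : x ∈ A) (hξ : B ≤ LinearMap.ker ξ) (h : ξ x = 1)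
    (hout : ∀ (t : Fin (n + 2)) (e : TypeAQuiver.Arrow up v t), v ≤ t → V.arr e x = 0)
    (hin : ∀ (s : Fin (n + 2)) (e : TypeAQuiver.Arrow up s v), v ≤ s → ξ ∘ₗ V.arr e = 0) :
    RightRetract V v A B where
  finish := v.val + 1
  lt_finish := Nat.lt_succ_self _
  finish_le := v.2
  vec := Pi.single v x
  form := Pi.single v ξ
  vec_eq_zero w hw := Pi.single_eq_of_ne (by rintro rfl; exact hw ⟨le_rfl, Nat.lt_succ_self _⟩) _
  form_eq_zero w hw := Pi.single_eq_of_ne (by rintro rfl; exact hw ⟨le_rfl, Nat.lt_succ_self _⟩) _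
  arr_vec s t e hs ht h := by
    obtain rfl : s = v := le_antisymm (Nat.lt_succ_iff.1 h) hs
    rw [Pi.single_eq_same, hout t e ht, Pi.single_eq_of_ne]
    rintro rfl
    have := arrow_val e
    lia
  form_arr s t e hs ht h := by
    obtain rfl : t = v := le_antisymm (Nat.lt_succ_iff.1 h) ht
    rw [Pi.single_eq_same, hin s e hs, Pi.single_eq_of_ne]
    rintro rfl
    have := arrow_val e
    lia
  vec_mem := by rwa [Pi.single_eq_same]
  le_ker_form := by rwa [Pi.single_eq_same]
  form_vec w hw hw' := by
    obtain rfl : w = v := le_antisymm (Nat.lt_succ_iff.1 hw') hw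
    rw [Pi.single_eq_same, Pi.single_eq_same, h]

open Classical in
/-- Extension of a retract by one vertex to the left. -/
noncomputable def cons {a : Fin (n + 1)} {A B : Submodule k (V.Space a.castSucc)}
    {A' B' : Submodule k (V.Space a.succ)} (R : RightRetract V a.succ A' B')
    (x : V.Space a.castSucc) (ξ : V.Space a.castSucc →ₗ[k] k) (hx : x ∈ A)
    (hξ : B ≤ LinearMap.ker ξ) (h : ξ x = 1)
    (hR : ∀ e : TypeAQuiver.Arrow up a.castSucc a.succ,
      V.arr e x = R.vec a.succ ∧ R.form a.succ ∘ₗ V.arr e = ξ)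
    (hL : ∀ e : TypeAQuiver.Arrow up a.succ a.castSucc,
      V.arr e (R.vec a.succ) = x ∧ ξ ∘ₗ V.arr e = R.form a.succ) :
    RightRetract V a.castSucc A B where
  finish := R.finish
  lt_finish := by have := R.lt_finish; simp at this ⊢; lia
  finish_le := R.finish_le
  vec := Function.update R.vec a.castSucc x
  form := Function.update R.form a.castSucc ξ
  vec_eq_zero w hw := by
    have := R.lt_finish
    rw [Function.update_of_ne (by rintro rfl; simp at hw this; lia)]
    exact R.vec_eq_zero w (by simp at hw ⊢; lia)
  form_eq_zero w hw := by
    have := R.lt_finish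
    rw [Function.update_of_ne (by rintro rfl; simp at hw this; lia)]
    exact R.form_eq_zero w (by simp at hw ⊢; lia)
  arr_vec s t e hs ht h := by
    have hv := arrow_val e
    rw [Fin.le_def, Fin.val_castSucc] at hs ht
    by_cases hsa : s = a.castSucc
    · obtain rfl : t = a.succ := by simp [Fin.ext_iff] at hsa ⊢; lia
      subst hsa
      rw [Function.update_self, Function.update_of_ne (by simp [Fin.ext_iff]), (hR e).1]
    by_cases hta : t = a.castSucc
    · obtain rfl : s = a.succ := by simp [Fin.ext_iff] at hta ⊢; lia
      subst hta
      rw [Function.update_self, Function.update_of_ne (by simp [Fin.ext_iff]), (hL e).1]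
    rw [Function.update_of_ne hsa, Function.update_of_ne hta]
    rw [Fin.ext_iff, Fin.val_castSucc] at hsa hta
    exact R.arr_vec s t e (by simp [Fin.le_def]; lia) (by simp [Fin.le_def]; lia) h
  form_arr s t e hs ht h := by
    have hv := arrow_val e
    rw [Fin.le_def, Fin.val_castSucc] at hs ht
    by_cases hsa : s = a.castSucc
    · obtain rfl : t = a.succ := by simp [Fin.ext_iff] at hsa ⊢; lia
      subst hsa
      rw [Function.update_self, Function.update_of_ne (by simp [Fin.ext_iff]), (hR e).2]
    by_cases hta : t = a.castSucc
    · obtain rfl : s = a.succ := by simp [Fin.ext_iff] at hta ⊢; lia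
      subst hta
      rw [Function.update_self, Function.update_of_ne (by simp [Fin.ext_iff]), (hL e).2]
    rw [Function.update_of_ne hsa, Function.update_of_ne hta]
    rw [Fin.ext_iff, Fin.val_castSucc] at hsa hta
    exact R.form_arr s t e (by simp [Fin.le_def]; lia) (by simp [Fin.le_def]; lia) h
  vec_mem := by rwa [Function.update_self]
  le_ker_form := by rwa [Function.update_self]
  form_vec w hw hw' := by
    by_cases hwa : w = a.castSucc
    · subst hwa; rw [Function.update_self, Function.update_self, h]
    · rw [Function.update_of_ne hwa, Function.update_of_ne hwa]
      exact R.form_vec w (by simp [Fin.ext_iff] at hw hwa ⊢; lia) hw'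

/-- Induction from the right end of the quiver. The flag `B ≤ A` carries the constraints imposed
from the left. It is transported along each arrow until a vector and a functional witnessing `A ≠ B`
can be split off. -/
lemma nonempty (V : TypeARep k up) (v : Fin (n + 2)) : ∀ A B : Submodule k (V.Space v), B ≤ A →
    ¬ A ≤ B → Nonempty (RightRetract V v A B) := by
  induction v using Fin.reverseInduction with
  | last =>
    intro A B _ hAB
    obtain ⟨x, hxA, hxB⟩ := SetLike.not_le_iff_exists.1 hAB
    obtain ⟨ξ, hξ, h1⟩ := B.exists_le_ker_apply_eq_one hxB
    refine ⟨single x ξ hxA hξ h1 (fun t e ht ↦ ?_) (fun t e ht ↦ ?_)⟩ <;>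
    · have := arrow_val e
      rw [Fin.le_def] at ht
      simp only [Fin.val_last] at this ht
      lia
  | cast a ih =>
    intro A B hBA hAB
    cases h : up a
    · have e : TypeAQuiver.Arrow up a.succ a.castSucc := .left a h
      have hno : TypeAQuiver.Arrow up a.castSucc a.succ → False := fun e' ↦ by
        simp [up_eq_true_of_arrow e' a rfl rfl] at h
      -- The arrow points to `a`. A vector of `A` outside `B` and the image splits off at `a` alone.
      -- Otherwise `A` modulo `B` comes from the right, and the flag is pulled back.
      by_cases hA : A ≤ B ⊔ LinearMap.range (V.arr e)
      · have hne : ¬ A.comap (V.arr e) ≤ B.comap (V.arr e) := fun hle ↦ hAB fun x hx ↦ by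
          obtain ⟨b, hb, _, ⟨y, rfl⟩, rfl⟩ := Submodule.mem_sup.1 (hA hx)
          exact B.add_mem hb (hle (Submodule.mem_comap.2
            ((A.add_mem_iff_right (hBA hb)).1 hx)))
        obtain ⟨R⟩ := ih _ _ (Submodule.comap_mono hBA) hne
        obtain ⟨ξ, hξ, hB⟩ :=
          LinearMap.exists_comp_eq_of_comap_le_ker (V.arr e) B _ R.le_ker_form
        refine ⟨R.cons (V.arr e (R.vec a.succ)) ξ R.vec_mem hB ?_ (fun e' ↦ (hno e').elim)
          fun e' ↦ ?_⟩
        · rw [← LinearMap.comp_apply, hξ, R.form_vec _ le_rfl R.lt_finish]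
        · rw [Subsingleton.elim e' e]; exact ⟨rfl, hξ⟩
      · obtain ⟨x, hxA, hxB⟩ := SetLike.not_le_iff_exists.1 hA
        obtain ⟨ξ, hξ, h1⟩ := Submodule.exists_le_ker_apply_eq_one _ hxB
        refine ⟨single x ξ hxA (le_sup_left.trans hξ) h1 (fun t e' ht ↦ ?_) fun s e' hs ↦ ?_⟩
        · obtain rfl : t = a.succ := by
            have := arrow_val e'
            simp [Fin.ext_iff, Fin.le_def] at this ht ⊢; lia
          exact (hno e').elim
        · obtain rfl : s = a.succ := by
            have := arrow_val e'
            simp [Fin.ext_iff, Fin.le_def] at this hs ⊢; lia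
          rw [Subsingleton.elim e' e]
          ext y
          exact hξ (le_sup_right (a := B) ⟨y, rfl⟩)
    · have e : TypeAQuiver.Arrow up a.castSucc a.succ := .right a h
      have hno : TypeAQuiver.Arrow up a.succ a.castSucc → False := fun e' ↦ by
        simp [up_eq_false_of_arrow e' a rfl rfl] at h
      -- The arrow leaves `a`. A vector of `A` outside `B` which the arrow kills splits off at `a`
      -- alone. Otherwise the arrow is injective on `A` modulo `B`, and the flag is pushed forward.
      by_cases hA : A ⊓ LinearMap.ker (V.arr e) ≤ B
      · have hne : ¬ A.map (V.arr e) ≤ B.map (V.arr e) := fun hle ↦ hAB fun x hx ↦ by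
          obtain ⟨b, hb, hbx⟩ := hle (Submodule.mem_map_of_mem hx)
          have : x - b ∈ B := hA ⟨A.sub_mem hx (hBA hb), by simp [hbx]⟩
          exact (B.sub_mem_iff_left hb).1 this
        obtain ⟨R⟩ := ih _ _ (Submodule.map_mono hBA) hne
        obtain ⟨x, hxA, hx⟩ := R.vec_mem
        refine ⟨R.cons x (R.form a.succ ∘ₗ V.arr e) hxA (fun b hb ↦ ?_) ?_ (fun e' ↦ ?_)
          (fun e' ↦ (hno e').elim)⟩
        · exact R.le_ker_form (Submodule.mem_map_of_mem hb)
        · rw [LinearMap.comp_apply, hx, R.form_vec _ le_rfl R.lt_finish]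
        · rw [Subsingleton.elim e' e]; exact ⟨hx, rfl⟩
      · obtain ⟨x, hxA, hxB⟩ := SetLike.not_le_iff_exists.1 hA
        obtain ⟨ξ, hξ, h1⟩ := Submodule.exists_le_ker_apply_eq_one _ hxB
        refine ⟨single x ξ hxA.1 hξ h1 (fun t e' ht ↦ ?_) fun s e' hs ↦ ?_⟩
        · obtain rfl : t = a.succ := by
            have := arrow_val e'
            simp [Fin.ext_iff, Fin.le_def] at this ht ⊢; lia
          rw [Subsingleton.elim e' e]
          exact hxA.2
        · obtain rfl : s = a.succ := by
            have := arrow_val e'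
            simp [Fin.ext_iff, Fin.le_def] at this hs ⊢; lia
          exact (hno e').elim

end RightRetract

/-- Every nonzero representation has a segment representation as a retract. -/
lemma exists_segmentRep_retract (V : TypeARep k up) (hV : ¬ IsZero V) :
    ∃ (γ : PolygonSegment n) (i : segmentRep k up γ ⟶ V) (r : V ⟶ segmentRep k up γ),
      i ≫ r = 𝟙 _ := by
  classical
  -- Start at the leftmost nonzero vertex space: nothing is imposed from the left there, so the flag
  -- is `⊥ < ⊤`.
  have hex : ∃ m, ∃ h : m < n + 2, ∃ x : V.Space ⟨m, h⟩, x ≠ 0 := by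
    by_contra! H
    exact hV (isZero_iff.2 fun v x ↦ H v.val v.2 x)
  obtain ⟨hm, x, hx⟩ := Nat.find_spec hex
  set m := Nat.find hex
  have hmin : ∀ v : Fin (n + 2), v.val < m → ∀ x : V.Space v, x = 0 := fun v hv x ↦ by
    by_contra h
    exact Nat.find_min hex hv ⟨v.2, x, h⟩
  obtain ⟨R⟩ := RightRetract.nonempty V ⟨m, hm⟩ ⊤ ⊥ bot_le
    fun h ↦ hx ((Submodule.mem_bot k).1 (h (Submodule.mem_top (x := x))))
  have hlt := R.lt_finish
  have hle := R.finish_le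
  simp only at hlt
  refine ⟨⟨(⟨m, by lia⟩, ⟨R.finish, by lia⟩), hlt⟩, fromThin R.vec R.vec_eq_zero fun s t e hs ↦ ?_,
    toThin R.form R.form_eq_zero fun s t e ht ↦ ?_, hom_ext fun v x ↦ val_injective v ?_⟩
  · by_cases ht : m ≤ t.val
    · exact R.arr_vec s t e hs.1 ht hs.2
    · rw [hmin t (by lia) (R.vec t), hmin t (by lia) (V.arr e _)]
  · by_cases hs : m ≤ s.val
    · exact R.form_arr s t e hs ht.1 ht.2
    · ext x
      rw [hmin s (by lia) x, map_zero, map_zero]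
  · rw [app_comp, val_app_toThin, app_fromThin, map_smul, app_id, smul_eq_mul]
    by_cases hv : m ≤ v.val ∧ v.val < R.finish
    · rw [R.form_vec v hv.1 hv.2, mul_one]
    · rw [val_eq_zero hv, zero_mul]

lemma exists_iso_segmentRep {V : TypeARep k up} (hV : Indecomposable V) :
    ∃ γ : PolygonSegment n, Nonempty (V ≅ segmentRep k up γ) := by
  obtain ⟨γ, i, r, h⟩ := exists_segmentRep_retract V hV.1
  have := isIso_of_indecomposable_of_retract hV (not_isZero_segmentRep γ) i r h
  exact ⟨γ, ⟨(asIso i).symm⟩⟩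

end TypeARep

/-! ### Vanishing of `Ext¹` -/

/-- The vertices of the polygon which lie above the line through the first and last vertex. -/
def UpperVertex {n : ℕ} (up : Fin (n + 1) → Bool) (m : ℕ) : Prop :=
  ∃ a : Fin (n + 1), a.val + 1 = m ∧ up a = true

/-- The combinatorial form of the condition that the segments `(i, j)` and `(k, l)` cross and that
the first one has the smaller slope, where `U` is the set of vertices on the upper side. -/
def CrossesUpward (U : ℕ → Prop) (i j k l : ℕ) : Prop :=
  max i k < min j l ∧ (i < k ∧ ¬ U k ∨ k < i ∧ U i) ∧ (j < l ∧ ¬ U j ∨ l < j ∧ U l)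

/-- `CrossesUpward` for the line segments of the polygon. -/
def PolygonSegment.CrossesUpward {n : ℕ} (up : Fin (n + 1) → Bool) (γ δ : PolygonSegment n) :
    Prop :=
  _root_.CrossesUpward (UpperVertex up) γ.1.1 γ.1.2 δ.1.1 δ.1.2

namespace TypeARep

variable {k : Type u} [Field k] {n : ℕ} {up : Fin (n + 1) → Bool}

lemma arrow_upper {s t : Fin (n + 2)} (e : TypeAQuiver.Arrow up s t) :
    s.val + 1 = t.val ∧ UpperVertex up t.val ∨ t.val + 1 = s.val ∧ ¬ UpperVertex up s.val := by
  rcases e with ⟨a, h⟩ | ⟨a, h⟩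
  · exact Or.inl ⟨by simp, a, by simp, h⟩
  · refine Or.inr ⟨by simp, ?_⟩
    rintro ⟨b, hb, hb'⟩
    obtain rfl : b = a := by simpa [Fin.ext_iff] using hb
    simp [h] at hb'

section Vanishing

/-- Extend `h` by a linear retraction at each vertex. The failure to commute with the arrows
vanishes on `K`, hence is a family of maps from `X` to `Y` along the arrows. Writing it as a
coboundary corrects the extension. -/
lemma subsingleton_ext_of_forall_cocycle (X Y : TypeARep k up)
    (H : ∀ φ : ∀ s t : Fin (n + 2), TypeAQuiver.Arrow up s t → (X.Space s →ₗ[k] Y.Space t),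
      ∃ u : ∀ v, X.Space v →ₗ[k] Y.Space v, ∀ s t e,
        φ s t e = Y.arr e ∘ₗ u s - u t ∘ₗ X.arr e) :
    Subsingleton (Abelian.Ext X Y 1) := by
  refine Abelian.Ext.subsingleton_one_of_forall_extends X Y fun K Z f g w hS h ↦ ?_
  choose ρ hρ using fun v ↦ LinearMap.exists_leftInverse_of_injective (app f v)
    (LinearMap.ker_eq_bot.2 (injective_of_shortExact hS v))
  choose σ hσ using fun v ↦ LinearMap.exists_rightInverse_of_surjective (app g v)
    (LinearMap.range_eq_top.2 (surjective_of_shortExact hS v))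
  obtain ⟨u, hu⟩ := H fun s t e ↦
    (Y.arr e ∘ₗ app h s ∘ₗ ρ s - app h t ∘ₗ ρ t ∘ₗ Z.arr e) ∘ₗ σ s
  have hρ' : ∀ v y, ρ v (app f v y) = y := fun v y ↦ LinearMap.congr_fun (hρ v) y
  have hσ' : ∀ v x, app g v (σ v x) = x := fun v x ↦ LinearMap.congr_fun (hσ v) x
  have hgf : ∀ v y, app g v (app f v y) = 0 := fun v y ↦ by rw [← app_comp, w, app_zero]
  refine ⟨ofApp (fun v ↦ app h v ∘ₗ ρ v - u v ∘ₗ app g v) fun s t e z ↦ ?_,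
    hom_ext fun v y ↦ ?_⟩
  · obtain ⟨y, hy⟩ := exact_of_shortExact hS s (z - σ s (app g s z))
      (by rw [map_sub, hσ', sub_self])
    have h1 := LinearMap.congr_fun (hu s t e) (app g s z)
    have h2 : z = app f s y + σ s (app g s z) := by rw [hy]; abel
    have h3 : ρ t (Z.arr e (app f s y)) = K.arr e y := by rw [← app_arr, hρ']
    simp only [LinearMap.comp_apply, LinearMap.sub_apply] at h1 ⊢
    rw [app_arr]
    have h4 : app h t (ρ t (Z.arr e z)) =
        Y.arr e (app h s y) + app h t (ρ t (Z.arr e (σ s (app g s z)))) := by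
      conv_lhs => rw [h2]
      rw [map_add, map_add, map_add, h3, app_arr]
    have h5 : Y.arr e (app h s (ρ s z)) =
        Y.arr e (app h s y) + Y.arr e (app h s (ρ s (σ s (app g s z)))) := by
      conv_lhs => rw [h2]
      rw [map_add, map_add, map_add, hρ']
    rw [map_sub, h4, h5]
    rw [← sub_eq_zero] at h1 ⊢
    rw [← neg_eq_zero, ← h1]
    abel
  · simp [hρ', hgf]

variable {S S' : Fin (n + 2) → Prop}

/-- Unless source or target of `ψ` is zero, the hypothesis makes the arrow injective.
`exists_postcomp_arr` is the dual statement, with a surjective arrow. -/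
lemma exists_precomp_arr {s t : Fin (n + 2)} (e : TypeAQuiver.Arrow up s t)
    (h : S s → S' t → S t) (ψ : (thin k up S).Space s →ₗ[k] (thin k up S').Space t) :
    ∃ u : (thin k up S).Space t →ₗ[k] (thin k up S').Space t,
      u ∘ₗ (thin k up S).arr e = ψ := by
  by_cases hs : S s
  swap
  · exact ⟨0, LinearMap.ext fun x ↦ by rw [eq_zero_of_not hs x, map_zero, map_zero]⟩
  by_cases ht : S' t
  swap
  · exact ⟨0, LinearMap.ext fun x ↦ (eq_zero_of_not ht _).trans (eq_zero_of_not ht _).symm⟩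
  have hinj : Function.Injective ((thin k up S).arr e) := fun x y hxy ↦ val_injective s (by
    rw [← val_arr_of e x (h hs ht), hxy, val_arr_of e y (h hs ht)])
  obtain ⟨r, hr⟩ := LinearMap.exists_leftInverse_of_injective _ (LinearMap.ker_eq_bot.2 hinj)
  exact ⟨ψ ∘ₗ r, by rw [LinearMap.comp_assoc, hr, LinearMap.comp_id]⟩

lemma exists_postcomp_arr {s t : Fin (n + 2)} (e : TypeAQuiver.Arrow up s t)
    (h : S s → S' t → S' s) (ψ : (thin k up S).Space s →ₗ[k] (thin k up S').Space t) :
    ∃ u : (thin k up S).Space s →ₗ[k] (thin k up S').Space s,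
      (thin k up S').arr e ∘ₗ u = ψ := by
  by_cases hs : S s
  swap
  · exact ⟨0, LinearMap.ext fun x ↦ by rw [eq_zero_of_not hs x, map_zero, map_zero]⟩
  by_cases ht : S' t
  swap
  · exact ⟨0, LinearMap.ext fun x ↦ (eq_zero_of_not ht _).trans (eq_zero_of_not ht _).symm⟩
  have hsurj : Function.Surjective ((thin k up S').arr e) := fun x ↦ by
    obtain ⟨y, hy⟩ := exists_val (k := k) (up := up) (S := S') (v := s) (val t x)
      fun h' ↦ (h' (h hs ht)).elim
    exact ⟨y, val_injective t (by rw [val_arr_of e y ht, hy])⟩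
  obtain ⟨r, hr⟩ := LinearMap.exists_rightInverse_of_surjective _ (LinearMap.range_eq_top.2 hsurj)
  exact ⟨r ∘ₗ ψ, by rw [← LinearMap.comp_assoc, hr, LinearMap.id_comp]⟩

/-- The coboundary equation is solved from left to right, starting with `0`. Each arrow involves
only one new unknown, and the hypotheses are the solvability conditions. -/
lemma subsingleton_ext_of_rightward
    (hr : ∀ s t : Fin (n + 2), TypeAQuiver.Arrow up s t → s < t → S s → S' t → S t)
    (hl : ∀ s t : Fin (n + 2), TypeAQuiver.Arrow up s t → t < s → S s → S' t → S' s) :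
    Subsingleton (Abelian.Ext (thin k up S) (thin k up S') 1) := by
  refine subsingleton_ext_of_forall_cocycle _ _ fun φ ↦ ?_
  have step : ∀ (a : Fin (n + 1))
      (u : (thin k up S).Space a.castSucc →ₗ[k] (thin k up S').Space a.castSucc),
      ∃ u' : (thin k up S).Space a.succ →ₗ[k] (thin k up S').Space a.succ,
        (∀ e, φ a.castSucc a.succ e = (thin k up S').arr e ∘ₗ u - u' ∘ₗ (thin k up S).arr e) ∧
        ∀ e, φ a.succ a.castSucc e = (thin k up S').arr e ∘ₗ u' - u ∘ₗ (thin k up S).arr e := by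
    intro a u
    cases h : up a
    · obtain ⟨u', hu'⟩ := exists_postcomp_arr (.left a h) (hl _ _ (.left a h) (by simp))
        (φ _ _ (.left a h) + u ∘ₗ (thin k up S).arr (.left a h))
      refine ⟨u', fun e ↦ ?_, fun e ↦ ?_⟩
      · simp [up_eq_true_of_arrow e a rfl rfl] at h
      · rw [Subsingleton.elim e (.left a h), hu', add_sub_cancel_right]
    · obtain ⟨u', hu'⟩ := exists_precomp_arr (.right a h) (hr _ _ (.right a h) (by simp))
        ((thin k up S').arr (.right a h) ∘ₗ u - φ _ _ (.right a h))
      refine ⟨u', fun e ↦ ?_, fun e ↦ ?_⟩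
      · rw [Subsingleton.elim e (.right a h), hu', sub_sub_cancel]
      · simp [up_eq_false_of_arrow e a rfl rfl] at h
  choose next hnext using step
  let u : ∀ v, (thin k up S).Space v →ₗ[k] (thin k up S').Space v :=
    fun v ↦ Fin.induction (motive := fun v ↦ (thin k up S).Space v →ₗ[k] (thin k up S').Space v)
      0 next v
  have hu : ∀ a : Fin (n + 1), u a.succ = next a (u a.castSucc) := fun a ↦
    Fin.induction_succ _ _ a
  refine ⟨u, ?_⟩
  rintro s t (⟨a, h⟩ | ⟨a, h⟩)
  · rw [hu]; exact (hnext a (u a.castSucc)).1 _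
  · rw [hu]; exact (hnext a (u a.castSucc)).2 _

lemma subsingleton_ext_of_leftward
    (hr : ∀ s t : Fin (n + 2), TypeAQuiver.Arrow up s t → s < t → S s → S' t → S' s)
    (hl : ∀ s t : Fin (n + 2), TypeAQuiver.Arrow up s t → t < s → S s → S' t → S t) :
    Subsingleton (Abelian.Ext (thin k up S) (thin k up S') 1) := by
  refine subsingleton_ext_of_forall_cocycle _ _ fun φ ↦ ?_
  have step : ∀ (a : Fin (n + 1))
      (u' : (thin k up S).Space a.succ →ₗ[k] (thin k up S').Space a.succ),
      ∃ u : (thin k up S).Space a.castSucc →ₗ[k] (thin k up S').Space a.castSucc,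
        (∀ e, φ a.castSucc a.succ e = (thin k up S').arr e ∘ₗ u - u' ∘ₗ (thin k up S).arr e) ∧
        ∀ e, φ a.succ a.castSucc e = (thin k up S').arr e ∘ₗ u' - u ∘ₗ (thin k up S).arr e := by
    intro a u'
    cases h : up a
    · obtain ⟨u, hu⟩ := exists_precomp_arr (.left a h) (hl _ _ (.left a h) (by simp))
        ((thin k up S').arr (.left a h) ∘ₗ u' - φ _ _ (.left a h))
      refine ⟨u, fun e ↦ ?_, fun e ↦ ?_⟩
      · simp [up_eq_true_of_arrow e a rfl rfl] at h
      · rw [Subsingleton.elim e (.left a h), hu, sub_sub_cancel]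
    · obtain ⟨u, hu⟩ := exists_postcomp_arr (.right a h) (hr _ _ (.right a h) (by simp))
        (φ _ _ (.right a h) + u' ∘ₗ (thin k up S).arr (.right a h))
      refine ⟨u, fun e ↦ ?_, fun e ↦ ?_⟩
      · rw [Subsingleton.elim e (.right a h), hu, add_sub_cancel_right]
      · simp [up_eq_false_of_arrow e a rfl rfl] at h
  choose next hnext using step
  let u : ∀ v, (thin k up S).Space v →ₗ[k] (thin k up S').Space v :=
    fun v ↦ Fin.reverseInduction
      (motive := fun v ↦ (thin k up S).Space v →ₗ[k] (thin k up S').Space v) 0 next v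
  have hu : ∀ a : Fin (n + 1), u a.castSucc = next a (u a.succ) := fun a ↦
    Fin.reverseInduction_castSucc _
  refine ⟨u, ?_⟩
  rintro s t (⟨a, h⟩ | ⟨a, h⟩)
  · rw [hu]; exact (hnext a (u a.succ)).1 _
  · rw [hu]; exact (hnext a (u a.succ)).2 _

lemma subsingleton_ext_segmentRep {γ δ : PolygonSegment n} (h : ¬ δ.CrossesUpward up γ)
    (h₁ : ¬ (δ.1.1 = γ.1.2 ∧ UpperVertex up γ.1.2))
    (h₂ : ¬ (γ.1.1 = δ.1.2 ∧ ¬ UpperVertex up γ.1.1)) :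
    Subsingleton (Abelian.Ext (segmentRep k up γ) (segmentRep k up δ) 1) := by
  obtain ⟨⟨⟨i, hi⟩, ⟨j, hj⟩⟩, hij⟩ := γ
  obtain ⟨⟨⟨i', hi'⟩, ⟨j', hj'⟩⟩, hij'⟩ := δ
  simp only [PolygonSegment.CrossesUpward, CrossesUpward, Fin.mk.injEq] at *
  -- This says exactly that solving to the right is obstructed, which can happen only at a right end
  -- of a support. Solving to the left is obstructed only at a left end. Both fail together only if
  -- the segments cross or meet end to end.
  by_cases hR : (i' ≤ j ∧ j < j' ∧ UpperVertex up j) ∨ (i ≤ j' ∧ j' < j ∧ ¬ UpperVertex up j')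
  · apply subsingleton_ext_of_leftward
    · intro s t e hst hs ht
      have := arrow_upper e
      grind
    · intro s t e hst hs ht
      have := arrow_upper e
      grind
  · apply subsingleton_ext_of_rightward
    · intro s t e hst hs ht
      have := arrow_upper e
      grind
    · intro s t e hst hs ht
      have := arrow_upper e
      grind

end Vanishing

end TypeARep

/-! ### Explicit extensions and the compatibility of two segments -/

namespace TypeARep

variable {k : Type u} [Field k] {n : ℕ} {up : Fin (n + 1) → Bool}

lemma app_biprod {V W : TypeARep k up} (v : Fin (n + 2)) (x : (V ⊞ W).Space v) :
    x = app biprod.inl v (app biprod.fst v x) + app biprod.inr v (app biprod.snd v x) := by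
  conv_lhs => rw [← app_id (V := V ⊞ W) v x, ← biprod.total]
  rfl

/-- A short exact sequence from a square which is bicartesian at each vertex. -/
lemma shortExact_of_square {Y E E' X : TypeARep k up} (p : Y ⟶ E) (q : Y ⟶ E') (a : E ⟶ X)
    (b : E' ⟶ X) (w : biprod.lift p q ≫ biprod.desc a (-b) = 0)
    (hinj : ∀ v y, app p v y = 0 → app q v y = 0 → y = 0)
    (hsurj : ∀ v x, ∃ e e', app a v e - app b v e' = x)
    (hex : ∀ v e e', app a v e = app b v e' → ∃ y, app p v y = e ∧ app q v y = e') :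
    (ShortComplex.mk (biprod.lift p q) (biprod.desc a (-b)) w).ShortExact := by
  have hp : ∀ v y, app p v y = app biprod.fst v (app (biprod.lift p q) v y) := fun v y ↦ by
    rw [← app_comp, biprod.lift_fst]
  have hq : ∀ v y, app q v y = app biprod.snd v (app (biprod.lift p q) v y) := fun v y ↦ by
    rw [← app_comp, biprod.lift_snd]
  have ha : ∀ v e, app (biprod.desc a (-b)) v (app biprod.inl v e) = app a v e := fun v y ↦ by
    rw [← app_comp, biprod.inl_desc]
  have hb : ∀ v e, app (biprod.desc a (-b)) v (app biprod.inr v e) = - app b v e := fun v y ↦ by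
    rw [← app_comp, biprod.inr_desc]; rfl
  refine shortExact_of_app (fun v ↦ ?_) (fun v x ↦ ?_) fun v x hx ↦ ?_
  · refine (injective_iff_map_eq_zero _).2 fun y hy ↦ hinj v y ?_ ?_
    · rw [hp, hy, map_zero]
    · rw [hq, hy, map_zero]
  · obtain ⟨e, e', h⟩ := hsurj v x
    exact ⟨app biprod.inl v e + app biprod.inr v e', by
      rw [map_add, ha, hb, ← sub_eq_add_neg, h]⟩
  · rw [app_biprod v x, map_add, ha, hb, ← sub_eq_add_neg, sub_eq_zero] at hx
    obtain ⟨y, h1, h2⟩ := hex v _ _ hx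
    refine ⟨y, ?_⟩
    rw [app_biprod v (app (biprod.lift p q) v y), ← hp, ← hq, h1, h2, ← app_biprod]

/-- The conditions on arrows make the four maps natural. The last two say that the supports have
equal intersections and unions, which makes the square bicartesian at each vertex. -/
lemma exists_shortExact_thin {Y E E' X : Fin (n + 2) → Prop}
    (hp : ∀ s t : Fin (n + 2), TypeAQuiver.Arrow up s t → Y s → E t → (Y t ↔ E s))
    (hq : ∀ s t : Fin (n + 2), TypeAQuiver.Arrow up s t → Y s → E' t → (Y t ↔ E' s))
    (ha : ∀ s t : Fin (n + 2), TypeAQuiver.Arrow up s t → E s → X t → (E t ↔ X s))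
    (hb : ∀ s t : Fin (n + 2), TypeAQuiver.Arrow up s t → E' s → X t → (E' t ↔ X s))
    (hand : ∀ v, E v ∧ E' v ↔ Y v ∧ X v) (hor : ∀ v, E v ∨ E' v ↔ Y v ∨ X v) :
    ∃ (f : thin k up Y ⟶ thin k up E ⊞ thin k up E') (g : thin k up E ⊞ thin k up E' ⟶ thin k up X)
      (w : f ≫ g = 0), (ShortComplex.mk f g w).ShortExact := by
  classical
  refine ⟨biprod.lift (thinMap hp) (thinMap hq), biprod.desc (thinMap ha) (-thinMap hb), ?_,
    shortExact_of_square _ _ _ _ _ (fun v y h1 h2 ↦ ?_) (fun v x ↦ ?_) fun v e e' h ↦ ?_⟩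
  · rw [biprod.lift_desc, Preadditive.comp_neg, ← sub_eq_add_neg, sub_eq_zero]
    refine hom_ext fun v y ↦ val_injective v ?_
    simp only [app_comp, val_app_thinMap]
    by_cases hX : X v
    · by_cases hY : Y v
      · simp [hX, (hand v).2 ⟨hY, hX⟩]
      · simp [val_eq_zero hY y]
    · simp [hX]
  · by_cases hY : Y v
    · have h1' := congrArg (val v) h1
      have h2' := congrArg (val v) h2
      rw [val_app_thinMap, map_zero] at h1' h2'
      refine val_injective v ?_
      rw [map_zero]
      rcases (hor v).2 (Or.inl hY) with h | h
      · rwa [if_pos h] at h1'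
      · rwa [if_pos h] at h2'
    · exact eq_zero_of_not hY y
  · by_cases hX : X v
    · by_cases hE : E v
      · obtain ⟨e, he⟩ := exists_val (k := k) (up := up) (S := E) (val v x) fun h ↦ (h hE).elim
        exact ⟨e, 0, val_injective v (by simp [val_app_thinMap, hX, he])⟩
      · have hE' := ((hor v).2 (Or.inr hX)).resolve_left hE
        obtain ⟨e, he⟩ := exists_val (k := k) (up := up) (S := E') (-val v x) fun h ↦ (h hE').elim
        exact ⟨0, e, val_injective v (by simp [val_app_thinMap, hX, he])⟩
    · exact ⟨0, 0, by rw [eq_zero_of_not hX x]; simp⟩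
  · have h' := congrArg (val v) h
    rw [val_app_thinMap, val_app_thinMap] at h'
    have h1 := hand v
    have h2 := hor v
    obtain ⟨y, hy⟩ := exists_val (k := k) (up := up) (S := Y)
      (if Y v then if E v then val v e else val v e' else 0) fun h ↦ if_neg h
    refine ⟨y, val_injective v ?_, val_injective v ?_⟩ <;> rw [val_app_thinMap, hy]
    · by_cases hE : E v
      · by_cases hY : Y v
        · simp [hE, hY]
        · have hE' : ¬ E' v := by tauto
          have hX : X v := by tauto
          simpa [hE, hY, hX, val_eq_zero hE'] using h'.symm
      · simp [hE, val_eq_zero hE]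
    · by_cases hE' : E' v
      · by_cases hE : E v
        · have hX : X v ∧ Y v := by tauto
          simpa [hE, hE', hX.1, hX.2] using h'
        · by_cases hY : Y v
          · simp [hE, hY, hE']
          · have hX : X v := by tauto
            simpa [hE', hY, hX, val_eq_zero hE] using h'
      · simp [hE', val_eq_zero hE']

lemma exists_shortExact_thin_of_disjoint {Y E X : Fin (n + 2) → Prop}
    (hp : ∀ s t : Fin (n + 2), TypeAQuiver.Arrow up s t → Y s → E t → (Y t ↔ E s))
    (ha : ∀ s t : Fin (n + 2), TypeAQuiver.Arrow up s t → E s → X t → (E t ↔ X s))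
    (hand : ∀ v, ¬ (Y v ∧ X v)) (hor : ∀ v, E v ↔ Y v ∨ X v) :
    ∃ (f : thin k up Y ⟶ thin k up E) (g : thin k up E ⟶ thin k up X)
      (w : f ≫ g = 0), (ShortComplex.mk f g w).ShortExact := by
  classical
  refine ⟨thinMap hp, thinMap ha, ?_, shortExact_of_app (fun v ↦ ?_) (fun v x ↦ ?_) fun v e he ↦ ?_⟩
  · refine hom_ext fun v y ↦ val_injective v ?_
    simp only [app_comp, val_app_thinMap, app_zero, map_zero]
    by_cases hX : X v
    · rw [eq_zero_of_not (fun hY ↦ hand v ⟨hY, hX⟩) y]; simp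
    · simp [hX]
  · refine (injective_iff_map_eq_zero _).2 fun y hy ↦ ?_
    by_cases hY : Y v
    · have h := congrArg (val v) hy
      rw [val_app_thinMap, if_pos ((hor v).2 (Or.inl hY)), map_zero] at h
      exact val_injective v (by rw [h, map_zero])
    · exact eq_zero_of_not hY y
  · by_cases hX : X v
    · obtain ⟨e, he⟩ := exists_val (k := k) (up := up) (S := E) (val v x)
        fun h ↦ (h ((hor v).2 (Or.inr hX))).elim
      exact ⟨e, val_injective v (by rw [val_app_thinMap, if_pos hX, he])⟩
    · exact ⟨0, by rw [eq_zero_of_not hX x, map_zero]⟩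
  · by_cases hY : Y v
    · obtain ⟨y, hy⟩ := exists_val (k := k) (up := up) (S := Y) (val v e) fun h ↦ (h hY).elim
      exact ⟨y, val_injective v (by rw [val_app_thinMap, if_pos ((hor v).2 (Or.inl hY)), hy])⟩
    · refine ⟨0, ?_⟩
      rw [map_zero]
      by_cases hX : X v
      · have h := congrArg (val v) he
        rw [val_app_thinMap, if_pos hX, map_zero] at h
        exact val_injective v (by rw [h, map_zero])
      · exact (eq_zero_of_not (fun h ↦ ((hor v).1 h).elim hY hX) e).symm

/-- A retraction of `f` would write the identity of `γ` as a sum of round trips through `δ` and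
`δ'`, which are zero. -/
lemma isEmpty_splitting_biprod {γ δ δ' : PolygonSegment n} {X : TypeARep k up} (h : γ ≠ δ)
    (h' : γ ≠ δ') {f : segmentRep k up γ ⟶ segmentRep k up δ ⊞ segmentRep k up δ'}
    {g : segmentRep k up δ ⊞ segmentRep k up δ' ⟶ X} {w : f ≫ g = 0} :
    IsEmpty (ShortComplex.mk f g w).Splitting := by
  refine ⟨fun s ↦ not_isZero_segmentRep (k := k) (up := up) γ ((IsZero.iff_id_eq_zero _).2 ?_)⟩
  obtain ⟨r, hs⟩ : ∃ r, f ≫ r = 𝟙 _ := ⟨s.r, s.f_r⟩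
  rw [← hs, ← Category.comp_id f, ← biprod.total, Preadditive.comp_add, Preadditive.add_comp]
  have h1 := segmentRep_comp_eq_zero h (f ≫ biprod.fst) (biprod.inl ≫ r)
  have h2 := segmentRep_comp_eq_zero h' (f ≫ biprod.snd) (biprod.inr ≫ r)
  simp only [Category.assoc] at h1 h2 ⊢
  rw [h1, h2, add_zero]

lemma isEmpty_splitting {γ δ : PolygonSegment n} {X : TypeARep k up} (h : γ ≠ δ)
    {f : segmentRep k up γ ⟶ segmentRep k up δ}
    {g : segmentRep k up δ ⟶ X} {w : f ≫ g = 0} :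
    IsEmpty (ShortComplex.mk f g w).Splitting := by
  refine ⟨fun s ↦ not_isZero_segmentRep (k := k) (up := up) γ ((IsZero.iff_id_eq_zero _).2 ?_)⟩
  have hs : f ≫ s.r = 𝟙 _ := s.f_r
  rw [← hs, segmentRep_comp_eq_zero h]

/-- The extension of the representations of two crossing segments. -/
lemma exists_shortExact_of_crossesUpward {γ δ : PolygonSegment n} (h : γ.CrossesUpward up δ)
    (h₁ : δ.1.1 < γ.1.2) (h₂ : γ.1.1 < δ.1.2) :
    ∃ (f : segmentRep k up γ ⟶ segmentRep k up ⟨(δ.1.1, γ.1.2), h₁⟩ ⊞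
        segmentRep k up ⟨(γ.1.1, δ.1.2), h₂⟩)
      (g : segmentRep k up ⟨(δ.1.1, γ.1.2), h₁⟩ ⊞ segmentRep k up ⟨(γ.1.1, δ.1.2), h₂⟩ ⟶
        segmentRep k up δ) (w : f ≫ g = 0),
      (ShortComplex.mk f g w).ShortExact ∧ IsEmpty (ShortComplex.mk f g w).Splitting := by
  have hne : γ ≠ ⟨(δ.1.1, γ.1.2), h₁⟩ := by
    rintro hγ
    have := h.2.1
    rw [congrArg (fun γ : PolygonSegment n ↦ γ.1.1) hγ] at this
    simp at this
  have hne' : γ ≠ ⟨(γ.1.1, δ.1.2), h₂⟩ := by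
    rintro hγ
    have := h.2.2
    rw [congrArg (fun γ : PolygonSegment n ↦ γ.1.2) hγ] at this
    simp at this
  obtain ⟨⟨⟨i, hi⟩, ⟨j, hj⟩⟩, hij⟩ := γ
  obtain ⟨⟨⟨i', hi'⟩, ⟨j', hj'⟩⟩, hij'⟩ := δ
  simp only [PolygonSegment.CrossesUpward, CrossesUpward, Fin.mk_lt_mk] at h hij hij' h₁ h₂
  obtain ⟨f, g, w, hS⟩ := exists_shortExact_thin (k := k) (up := up)
    (Y := fun v ↦ i ≤ v.val ∧ v.val < j) (E := fun v ↦ i' ≤ v.val ∧ v.val < j)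
    (E' := fun v ↦ i ≤ v.val ∧ v.val < j') (X := fun v ↦ i' ≤ v.val ∧ v.val < j')
    (fun s t e hs ht ↦ by have := arrow_upper e; grind)
    (fun s t e hs ht ↦ by have := arrow_upper e; grind)
    (fun s t e hs ht ↦ by have := arrow_upper e; grind)
    (fun s t e hs ht ↦ by have := arrow_upper e; grind)
    (fun v ↦ by grind) (fun v ↦ by grind)
  exact ⟨f, g, w, hS, isEmpty_splitting_biprod hne hne'⟩

/-- The extension of the representations of two segments which meet in an end point. -/
lemma exists_shortExact_of_adjacent {γ δ : PolygonSegment n}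
    (h : γ.1.1 = δ.1.2 ∧ UpperVertex up δ.1.2 ∨ δ.1.1 = γ.1.2 ∧ ¬ UpperVertex up δ.1.1) :
    ∃ (ε : PolygonSegment n) (f : segmentRep k up γ ⟶ segmentRep k up ε)
      (g : segmentRep k up ε ⟶ segmentRep k up δ) (w : f ≫ g = 0),
      (ShortComplex.mk f g w).ShortExact ∧ IsEmpty (ShortComplex.mk f g w).Splitting ∧
      Subsingleton (Abelian.Ext (segmentRep k up ε) (segmentRep k up γ) 1) := by
  obtain ⟨⟨⟨i, hi⟩, ⟨j, hj⟩⟩, hij⟩ := γ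
  obtain ⟨⟨⟨i', hi'⟩, ⟨j', hj'⟩⟩, hij'⟩ := δ
  simp only [Fin.mk_lt_mk, Fin.mk.injEq] at h hij hij'
  rcases h with ⟨rfl, h⟩ | ⟨rfl, h⟩
  · let ε : PolygonSegment n := ⟨(⟨i', hi'⟩, ⟨j, hj⟩), Fin.mk_lt_mk.2 (by lia)⟩
    obtain ⟨f, g, w, hS⟩ := exists_shortExact_thin_of_disjoint (k := k) (up := up)
      (Y := fun v ↦ i ≤ v.val ∧ v.val < j) (E := fun v ↦ i' ≤ v.val ∧ v.val < j)
      (X := fun v ↦ i' ≤ v.val ∧ v.val < i)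
      (fun s t e hs ht ↦ by have := arrow_upper e; grind)
      (fun s t e hs ht ↦ by have := arrow_upper e; grind)
      (fun v ↦ by grind) (fun v ↦ by grind)
    refine ⟨ε, f, g, w, hS, isEmpty_splitting (γ := ⟨(⟨i, hi⟩, ⟨j, hj⟩), Fin.mk_lt_mk.2 hij⟩)
      (δ := ε) fun h ↦ ?_,
      subsingleton_ext_segmentRep ?_ ?_ ?_⟩
    · simp [ε] at h; lia
    · rintro ⟨-, -, h⟩; simp [ε] at h
    · simp [ε]; lia
    · simp [ε]; lia
  · let ε : PolygonSegment n := ⟨(⟨i, hi⟩, ⟨j', hj'⟩), Fin.mk_lt_mk.2 (by lia)⟩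
    obtain ⟨f, g, w, hS⟩ := exists_shortExact_thin_of_disjoint (k := k) (up := up)
      (Y := fun v ↦ i ≤ v.val ∧ v.val < i') (E := fun v ↦ i ≤ v.val ∧ v.val < j')
      (X := fun v ↦ i' ≤ v.val ∧ v.val < j')
      (fun s t e hs ht ↦ by have := arrow_upper e; grind)
      (fun s t e hs ht ↦ by have := arrow_upper e; grind)
      (fun v ↦ by grind) (fun v ↦ by grind)
    refine ⟨ε, f, g, w, hS, isEmpty_splitting (γ := ⟨(⟨i, hi⟩, ⟨i', hj⟩), Fin.mk_lt_mk.2 hij⟩)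
      (δ := ε) fun h ↦ ?_,
      subsingleton_ext_segmentRep ?_ ?_ ?_⟩
    · simp [ε] at h; lia
    · rintro ⟨-, h, -⟩; simp [ε] at h
    · simp [ε]; lia
    · simp [ε]; lia

/-- The condition on a pair of indecomposable summands of an almost rigid representation. -/
def ExtCompatible (A B : TypeARep k up) : Prop :=
  Subsingleton (Abelian.Ext A B 1) ∨ ExtGeneratedByIndecomposable A B

/-- Either `Ext¹` vanishes or the segments meet end to end, and then their concatenation is an
indecomposable middle term. -/
lemma extCompatible_of_not_crossesUpward {A B : TypeARep k up} {γ δ : PolygonSegment n}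
    (eA : A ≅ segmentRep k up γ) (eB : B ≅ segmentRep k up δ) (h : ¬ δ.CrossesUpward up γ) :
    ExtCompatible A B := by
  by_cases hadj : δ.1.1 = γ.1.2 ∧ UpperVertex up γ.1.2 ∨ γ.1.1 = δ.1.2 ∧ ¬ UpperVertex up γ.1.1
  swap
  · have := subsingleton_ext_segmentRep (k := k) h (fun h' ↦ hadj (Or.inl h'))
      (fun h' ↦ hadj (Or.inr h'))
    exact Or.inl (Abelian.Ext.subsingleton_of_iso eA eB 1)
  right
  obtain ⟨ε, f, g, w, hS, hsplit, hE⟩ := exists_shortExact_of_adjacent (k := k) hadj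
  have w' : (eB.hom ≫ f) ≫ g ≫ eA.inv = 0 := by
    rw [Category.assoc, ← Category.assoc f, w, zero_comp, comp_zero]
  let e : ShortComplex.mk f g w ≅ ShortComplex.mk (eB.hom ≫ f) (g ≫ eA.inv) w' :=
    ShortComplex.isoMk eB.symm (Iso.refl _) eA.symm (by simp) (by simp)
  have hS' := ShortComplex.shortExact_of_iso e hS
  have hE' : Subsingleton (Abelian.Ext (segmentRep k up ε) B 1) :=
    Abelian.Ext.subsingleton_of_iso (Iso.refl _) eB 1
  have hEnd : ∀ b : B ⟶ B, ∃ c : k, b = c • 𝟙 _ := fun b ↦ by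
    obtain ⟨c, hc⟩ := segmentRep_end δ (eB.inv ≫ b ≫ eB.hom)
    refine ⟨c, ?_⟩
    have := congrArg (fun x ↦ eB.hom ≫ x ≫ eB.inv) hc
    simpa using this
  have hsplit' : IsEmpty (ShortComplex.mk (eB.hom ≫ f) (g ≫ eA.inv) w').Splitting :=
    ⟨fun s ↦ hsplit.false (s.ofIso e.symm)⟩
  obtain ⟨h1, h2⟩ := Abelian.Ext.finrank_one_and_span_extClass (k := k) hS' hsplit' hE' hEnd
  exact ⟨h1, _, _, _, _, hS', indecomposable_segmentRep ε, h2⟩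

/-- The exchange sequence shows that `Ext¹` is nonzero. An indecomposable middle term is impossible,
because its vertex spaces have dimension at most one and both outer terms are nonzero at a common
vertex. -/
lemma not_extCompatible_of_crossesUpward {γ δ : PolygonSegment n} (h : δ.CrossesUpward up γ) :
    ¬ ExtCompatible (segmentRep k up γ) (segmentRep k up δ) := by
  have hδ : δ.1.1.val < δ.1.2.val := δ.2
  have hγ : γ.1.1.val < γ.1.2.val := γ.2
  have hlt := h.1
  rintro (hsub | ⟨-, E, f, g, w, hS, hE, -⟩)
  · obtain ⟨f, g, w, hS, hsplit⟩ := exists_shortExact_of_crossesUpward (k := k) h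
      (Fin.lt_def.2 (by lia)) (Fin.lt_def.2 (by lia))
    exact (Abelian.Ext.nonempty_splitting_of_extClass_eq_zero hS (Subsingleton.elim _ _)).elim
      hsplit.false
  · obtain ⟨ε, ⟨e⟩⟩ := exists_iso_segmentRep hE
    -- The larger left end is a vertex in both supports.
    let v : Fin (n + 2) := ⟨max δ.1.1.val γ.1.1.val, by lia⟩
    obtain ⟨y, hy⟩ := exists_val (k := k) (up := up)
      (S := fun v ↦ δ.1.1.val ≤ v.val ∧ v.val < δ.1.2.val) (v := v) 1
      (fun h ↦ (h ⟨by simp [v], by simp only [v]; lia⟩).elim)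
    obtain ⟨x, hx⟩ := exists_val (k := k) (up := up)
      (S := fun v ↦ γ.1.1.val ≤ v.val ∧ v.val < γ.1.2.val) (v := v) 1
      (fun h ↦ (h ⟨by simp [v], by simp only [v]; lia⟩).elim)
    obtain ⟨z, hz⟩ := surjective_of_shortExact hS v x
    have hinj : Function.Injective (app e.hom v) := fun a b hab ↦ by
      have := congrArg (app e.inv v) hab
      rwa [← app_comp, ← app_comp, e.hom_inv_id, app_id, app_id] at this
    have hne : val v (app e.hom v (app f v y)) ≠ 0 := fun h0 ↦ by
      have h1 : app e.hom v (app f v y) = 0 := val_injective v (by rw [h0, map_zero])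
      have h2 := injective_of_shortExact hS v (hinj (h1.trans (map_zero _).symm) |>.trans
        (map_zero _).symm)
      rw [h2, map_zero] at hy
      exact zero_ne_one hy
    have hzy : z = (val v (app e.hom v z) / val v (app e.hom v (app f v y))) • app f v y :=
      hinj (val_injective v (by
        rw [map_smul, map_smul, smul_eq_mul, div_mul_cancel₀ _ hne]))
    have hx0 : x = 0 := by
      have hgf : app g v (app f v y) = 0 := by rw [← app_comp, w, app_zero]
      rw [← hz, hzy, map_smul, hgf, smul_zero]
    rw [hx0, map_zero] at hx
    exact zero_ne_one hx

end TypeARep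

/-! ### Basic representations as sets of segments -/

namespace TypeARep

variable {k : Type u} [Field k] {n : ℕ} {up : Fin (n + 1) → Bool}

lemma isSummand_iff {X T : TypeARep k up} :
    IsSummand X T ↔ ∃ (i : X ⟶ T) (r : T ⟶ X), i ≫ r = 𝟙 X := by
  refine ⟨?_, fun ⟨i, r, h⟩ ↦ exists_iso_biprod_of_retract i r h⟩
  rintro ⟨Y, ⟨e⟩⟩
  exact ⟨biprod.inl ≫ e.inv, e.hom ≫ biprod.fst, by simp⟩

lemma IsSummand.trans {X Y T : TypeARep k up} (h : IsSummand X Y) (h' : IsSummand Y T) :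
    IsSummand X T := by
  obtain ⟨i, r, hir⟩ := isSummand_iff.1 h
  obtain ⟨i', r', hir'⟩ := isSummand_iff.1 h'
  refine isSummand_iff.2 ⟨i ≫ i', r' ≫ r, ?_⟩
  rw [Category.assoc, ← Category.assoc i', hir', Category.id_comp, hir]

lemma IsSummand.of_iso {X T : TypeARep k up} (e : X ≅ T) : IsSummand X T :=
  isSummand_iff.2 ⟨e.hom, e.inv, e.hom_inv_id⟩

lemma isSummand_biprod_left (X Y : TypeARep k up) : IsSummand X (X ⊞ Y) :=
  isSummand_iff.2 ⟨biprod.inl, biprod.fst, by simp⟩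

lemma isSummand_biprod_right (X Y : TypeARep k up) : IsSummand Y (X ⊞ Y) :=
  isSummand_iff.2 ⟨biprod.inr, biprod.snd, by simp⟩

lemma IsBasic.of_isSummand {X T : TypeARep k up} (hT : IsBasic T) (h : IsSummand X T) :
    IsBasic X := fun A hA hX ↦ hT A hA (hX.trans h)

/-- The line segments whose representations are summands of `T`. -/
def segments (T : TypeARep k up) : Set (PolygonSegment n) :=
  {γ | IsSummand (segmentRep k up γ) T}

lemma mem_segments {T : TypeARep k up} {γ : PolygonSegment n} :
    γ ∈ segments T ↔ ∃ (i : segmentRep k up γ ⟶ T) (r : T ⟶ segmentRep k up γ), i ≫ r = 𝟙 _ :=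
  isSummand_iff

lemma IsSummand.segments_subset {X T : TypeARep k up} (h : IsSummand X T) :
    segments X ⊆ segments T := fun _ hγ ↦ IsSummand.trans hγ h

lemma segments_of_iso {X T : TypeARep k up} (e : X ≅ T) : segments X = segments T :=
  (IsSummand.of_iso e).segments_subset.antisymm (IsSummand.of_iso e.symm).segments_subset

/-- The composite is a scalar, and a nonzero scalar could be divided out to give a retraction. This
locality does the work of the Krull–Schmidt theorem below. -/
lemma segmentRep_comp (γ : PolygonSegment n) {T : TypeARep k up} (i : segmentRep k up γ ⟶ T)
    (r : T ⟶ segmentRep k up γ) (h : γ ∉ segments T) : i ≫ r = 0 := by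
  obtain ⟨c, hc⟩ := segmentRep_end γ (i ≫ r)
  by_cases h0 : c = 0
  · rw [hc, h0, zero_smul]
  · refine (h (mem_segments.2 ⟨c⁻¹ • i, r, ?_⟩)).elim
    rw [Linear.smul_comp, hc, smul_smul, inv_mul_cancel₀ h0, one_smul]

lemma segments_biprod (X Y : TypeARep k up) : segments (X ⊞ Y) = segments X ∪ segments Y := by
  refine Set.Subset.antisymm (fun γ hγ ↦ ?_) (Set.union_subset
    (isSummand_biprod_left X Y).segments_subset (isSummand_biprod_right X Y).segments_subset)
  by_contra hγ'
  obtain ⟨i, r, h⟩ := mem_segments.1 hγ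
  have h1 := segmentRep_comp γ (i ≫ biprod.fst) (biprod.inl ≫ r) (fun h ↦ hγ' (Or.inl h))
  have h2 := segmentRep_comp γ (i ≫ biprod.snd) (biprod.inr ≫ r) (fun h ↦ hγ' (Or.inr h))
  refine not_isZero_segmentRep (k := k) (up := up) γ ((IsZero.iff_id_eq_zero _).2 ?_)
  rw [← h, ← Category.comp_id i, ← biprod.total, Preadditive.comp_add, Preadditive.add_comp]
  simp only [Category.assoc] at h1 h2 ⊢
  rw [h1, h2, add_zero]

lemma segments_segmentRep (γ : PolygonSegment n) : segments (segmentRep k up γ) = {γ} := by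
  refine Set.Subset.antisymm (fun δ hδ ↦ ?_) (Set.singleton_subset_iff.2
    (mem_segments.2 ⟨𝟙 _, 𝟙 _, by simp⟩))
  obtain ⟨i, r, h⟩ := mem_segments.1 hδ
  by_contra hne
  rw [segmentRep_comp_eq_zero hne] at h
  exact not_isZero_segmentRep (k := k) (up := up) δ ((IsZero.iff_id_eq_zero _).2 h.symm)

lemma isZero_of_segments_eq_empty {T : TypeARep k up} (h : segments T = ∅) : IsZero T := by
  by_contra hT
  obtain ⟨γ, i, r, hir⟩ := exists_segmentRep_retract T hT
  exact (h ▸ mem_segments.2 ⟨i, r, hir⟩ : γ ∈ (∅ : Set _))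

lemma segments_eq_empty_of_isZero {T : TypeARep k up} (h : IsZero T) : segments T = ∅ := by
  refine Set.eq_empty_of_forall_notMem fun γ hγ ↦ ?_
  obtain ⟨i, r, hir⟩ := mem_segments.1 hγ
  rw [h.eq_of_tgt i 0, zero_comp] at hir
  exact not_isZero_segmentRep (k := k) (up := up) γ ((IsZero.iff_id_eq_zero _).2 hir.symm)

lemma isBasic_iff {T : TypeARep k up} : IsBasic T ↔ ∀ (γ : PolygonSegment n)
    (a₁ a₂ : segmentRep k up γ ⟶ T) (b₁ b₂ : T ⟶ segmentRep k up γ),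
    a₁ ≫ b₁ = 𝟙 _ → a₂ ≫ b₂ = 𝟙 _ → a₁ ≫ b₂ = 0 → a₂ ≫ b₁ = 0 → False := by
  constructor
  · intro hT γ a₁ a₂ b₁ b₂ h11 h22 h12 h21
    refine hT _ (indecomposable_segmentRep γ) (isSummand_iff.2
      ⟨biprod.desc a₁ a₂, biprod.lift b₁ b₂, ?_⟩)
    apply biprod.hom_ext <;> apply biprod.hom_ext' <;> simp [*]
  · intro H X hX hXT
    obtain ⟨γ, ⟨e⟩⟩ := exists_iso_segmentRep hX
    obtain ⟨i, r, h⟩ := isSummand_iff.1 hXT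
    have h' : ∀ {Z : TypeARep k up} (f : X ⊞ X ⟶ Z), i ≫ r ≫ f = f := fun f ↦ by
      rw [← Category.assoc, h, Category.id_comp]
    exact H γ (e.inv ≫ biprod.inl ≫ i) (e.inv ≫ biprod.inr ≫ i) (r ≫ biprod.fst ≫ e.hom)
      (r ≫ biprod.snd ≫ e.hom) (by simp [h']) (by simp [h']) (by simp [h']) (by simp [h'])

lemma IsBasic.notMem_segments {X Y : TypeARep k up} (h : IsBasic (X ⊞ Y)) {γ : PolygonSegment n}
    (hX : γ ∈ segments X) : γ ∉ segments Y := fun hY ↦ by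
  obtain ⟨i, r, hir⟩ := mem_segments.1 hX
  obtain ⟨i', r', hir'⟩ := mem_segments.1 hY
  exact isBasic_iff.1 h γ (i ≫ biprod.inl) (i' ≫ biprod.inr) (biprod.fst ≫ r) (biprod.snd ≫ r')
    (by simp [hir]) (by simp [hir']) (by simp) (by simp)

lemma IsBasic.segmentRep_biprod {Y : TypeARep k up} (hY : IsBasic Y) {γ : PolygonSegment n}
    (hγ : γ ∉ segments Y) : IsBasic (segmentRep k up γ ⊞ Y) := by
  refine isBasic_iff.2 fun δ a₁ a₂ b₁ b₂ h11 h22 h12 h21 ↦ ?_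
  have hsum : ∀ (a : segmentRep k up δ ⟶ segmentRep k up γ ⊞ Y) (b : _ ⟶ segmentRep k up δ),
      a ≫ b = (a ≫ biprod.fst) ≫ (biprod.inl ≫ b) + (a ≫ biprod.snd) ≫ (biprod.inr ≫ b) :=
    fun a b ↦ by
      conv_lhs => rw [← Category.comp_id a, ← biprod.total]
      rw [Preadditive.comp_add, Preadditive.add_comp]
      simp only [Category.assoc]
  rw [hsum] at h11 h22 h12 h21
  by_cases hδ : δ = γ
  · subst hδ
    -- Only the components through the one copy of `γ` remain, and these are scalars. They cannot
    -- hold two orthogonal idempotent pairs.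
    rw [segmentRep_comp δ (_ ≫ biprod.snd) _ hγ, add_zero] at h11 h22 h12 h21
    obtain ⟨α₁, hα₁⟩ := segmentRep_end δ (a₁ ≫ biprod.fst)
    obtain ⟨β₁, hβ₁⟩ := segmentRep_end δ (biprod.inl ≫ b₁)
    obtain ⟨β₂, hβ₂⟩ := segmentRep_end δ (biprod.inl ≫ b₂)
    have hne : 𝟙 (segmentRep k up δ) ≠ 0 := fun h ↦
      not_isZero_segmentRep (k := k) (up := up) δ ((IsZero.iff_id_eq_zero _).2 h)
    rw [hα₁, hβ₁, Linear.smul_comp, Category.id_comp] at h11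
    rw [hα₁, hβ₂, Linear.smul_comp, Category.id_comp] at h12
    rcases smul_eq_zero.1 h12 with h | h
    · rw [h, zero_smul] at h11
      exact hne h11.symm
    · rw [hβ₂, h, comp_zero] at h22
      exact hne h22.symm
  · rw [segmentRep_comp_eq_zero hδ, zero_add] at h11 h22 h12 h21
    exact isBasic_iff.1 hY δ _ _ _ _ h11 h22 h12 h21

lemma exists_iso_biprod_of_mem_segments {T : TypeARep k up} (hT : IsBasic T)
    {γ : PolygonSegment n} (hγ : γ ∈ segments T) :
    ∃ R : TypeARep k up, Nonempty (T ≅ segmentRep k up γ ⊞ R) ∧ IsBasic R ∧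
      segments R = segments T \ {γ} := by
  obtain ⟨R, ⟨e⟩⟩ := hγ
  have hb := hT.of_isSummand (IsSummand.of_iso e.symm)
  refine ⟨R, ⟨e⟩, hb.of_isSummand (isSummand_biprod_right _ _), ?_⟩
  have h1 := hb.notMem_segments (γ := γ) (by rw [segments_segmentRep]; rfl)
  rw [segments_of_iso e, segments_biprod, segments_segmentRep]
  rw [Set.union_sdiff_left, Set.sdiff_singleton_eq_self h1]

/-- Split off one common segment at a time; basicness ensures that it disappears from the set of the
complement. -/
lemma nonempty_iso_of_segments_eq {T₁ T₂ : TypeARep k up} (h₁ : IsBasic T₁) (h₂ : IsBasic T₂)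
    (h : segments T₁ = segments T₂) : Nonempty (T₁ ≅ T₂) := by
  generalize hS : segments T₁ = S at h
  induction S, S.toFinite using Set.Finite.induction_on generalizing T₁ T₂ with
  | empty => exact ⟨(isZero_of_segments_eq_empty hS).iso (isZero_of_segments_eq_empty h.symm)⟩
  | @insert γ S hγ _ ih =>
    obtain ⟨R₁, ⟨e₁⟩, hb₁, hR₁⟩ := exists_iso_biprod_of_mem_segments h₁
      (hS ▸ Set.mem_insert γ S : γ ∈ segments T₁)
    obtain ⟨R₂, ⟨e₂⟩, hb₂, hR₂⟩ := exists_iso_biprod_of_mem_segments h₂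
      (h ▸ Set.mem_insert γ S : γ ∈ segments T₂)
    rw [hS, Set.insert_sdiff_self_of_notMem hγ] at hR₁
    rw [← h, Set.insert_sdiff_self_of_notMem hγ] at hR₂
    obtain ⟨e⟩ := ih hb₁ hb₂ hR₁ hR₂.symm
    exact ⟨e₁ ≪≫ biprod.mapIso (Iso.refl _) e ≪≫ e₂.symm⟩

lemma exists_isBasic_segments_eq (k : Type u) [Field k] (up : Fin (n + 1) → Bool)
    (S : Set (PolygonSegment n)) : ∃ T : TypeARep k up, IsBasic T ∧ segments T = S := by
  induction S, S.toFinite using Set.Finite.induction_on with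
  | empty =>
    obtain ⟨Z, hZ⟩ := HasZeroObject.zero (C := TypeARep k up)
    have h0 := segments_eq_empty_of_isZero hZ
    refine ⟨Z, isBasic_iff.2 fun γ a₁ a₂ b₁ b₂ h _ _ _ ↦ ?_, h0⟩
    exact (h0 ▸ mem_segments.2 ⟨a₁, b₁, h⟩ : γ ∈ (∅ : Set _))
  | @insert γ S hγ _ ih =>
    obtain ⟨R, hb, hR⟩ := ih
    exact ⟨_, hb.segmentRep_biprod (hR ▸ hγ), by
      rw [segments_biprod, segments_segmentRep, hR, Set.singleton_union]⟩

end TypeARep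

/-! ### Almost rigid means noncrossing -/

/-- A set of line segments no two of which cross, combinatorially. -/
def NonCrossing {n : ℕ} (up : Fin (n + 1) → Bool) (S : Set (PolygonSegment n)) : Prop :=
  ∀ γ ∈ S, ∀ δ ∈ S, ¬ γ.CrossesUpward up δ

lemma NonCrossing.mono {n : ℕ} {up : Fin (n + 1) → Bool} {S S' : Set (PolygonSegment n)}
    (h : NonCrossing up S') (hS : S ⊆ S') : NonCrossing up S :=
  fun γ hγ δ hδ ↦ h γ (hS hγ) δ (hS hδ)

namespace TypeARep

variable {k : Type u} [Field k] {n : ℕ} {up : Fin (n + 1) → Bool}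

lemma isAlmostRigid_iff {T : TypeARep k up} :
    IsAlmostRigid T ↔ IsBasic T ∧ NonCrossing up (segments T) := by
  refine and_congr_right fun _ ↦ ⟨fun h γ hγ δ hδ hc ↦ ?_, fun h A B hA hB hAT hBT ↦ ?_⟩
  · exact not_extCompatible_of_crossesUpward (k := k) hc
      (h _ _ (indecomposable_segmentRep δ) (indecomposable_segmentRep γ) hδ hγ)
  · obtain ⟨γ, ⟨eA⟩⟩ := exists_iso_segmentRep hA
    obtain ⟨δ, ⟨eB⟩⟩ := exists_iso_segmentRep hB
    exact extCompatible_of_not_crossesUpward eA eB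
      (h δ ((IsSummand.of_iso eB.symm).trans hBT) γ ((IsSummand.of_iso eA.symm).trans hAT))

lemma isMaximalAlmostRigid_iff {T : TypeARep k up} :
    IsMaximalAlmostRigid T ↔ IsBasic T ∧ Maximal (NonCrossing up) (segments T) := by
  rw [IsMaximalAlmostRigid, isAlmostRigid_iff, and_assoc]
  refine and_congr_right fun hb ↦ and_congr_right fun _ ↦ ⟨fun h S hS hTS γ hγ ↦ ?_,
    fun h M hM hTM ↦ ?_⟩
  · by_contra hγT
    refine h (segmentRep k up γ) (not_isZero_segmentRep γ) (isAlmostRigid_iff.2 ⟨?_, ?_⟩)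
    · exact (hb.segmentRep_biprod hγT).of_isSummand (IsSummand.of_iso (biprod.braiding _ _))
    · rw [segments_biprod, segments_segmentRep]
      exact NonCrossing.mono hS (Set.union_subset hTS (Set.singleton_subset_iff.2 hγ))
  -- A nonzero `M` contains some segment. By maximality it already belongs to `T`, so `T ⊞ M` would
  -- repeat it.
  · obtain ⟨hb', hS⟩ := isAlmostRigid_iff.1 hTM
    obtain ⟨γ, i, r, hir⟩ := exists_segmentRep_retract M hM
    have hγM : γ ∈ segments M := mem_segments.2 ⟨i, r, hir⟩
    rw [segments_biprod] at hS
    exact hb'.notMem_segments (h hS Set.subset_union_left (Or.inr hγM)) hγM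

end TypeARep

/-! ### Crossings and slopes in the convex polygon -/

/-- On the vertical line through `p`, the point `p` lies between a point of the segment `ab` and a
point of the segment `cd`. -/
lemma mem_convexHull_of_between {a b c d p : ℝ × ℝ} (hap : a.1 < p.1) (hpb : p.1 < b.1)
    (hcp : c.1 < p.1) (hpd : p.1 < d.1) (hab : b.2 = a.2)
    (h : a.2 < p.2 ∧ p.2 ≤ c.2 + (d.2 - c.2) / (d.1 - c.1) * (p.1 - c.1) ∨
      p.2 < a.2 ∧ c.2 + (d.2 - c.2) / (d.1 - c.1) * (p.1 - c.1) ≤ p.2) :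
    p ∈ convexHull ℝ {a, b, c, d} := by
  have key : ∀ {u v q : ℝ × ℝ}, u ∈ convexHull ℝ {a, b, c, d} → v ∈ convexHull ℝ {a, b, c, d} →
      ∀ t : ℝ, 0 ≤ t → t ≤ 1 → (1 - t) • u + t • v = q → q ∈ convexHull ℝ {a, b, c, d} := by
    rintro u v _ hu hv t h0 h1 rfl
    exact convex_convexHull ℝ _ hu hv (by linarith) h0 (by ring)
  have hsub := subset_convexHull ℝ ({a, b, c, d} : Set (ℝ × ℝ))
  set z := c.2 + (d.2 - c.2) / (d.1 - c.1) * (p.1 - c.1) with hz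
  have hab' : 0 < b.1 - a.1 := by linarith
  have hcd' : 0 < d.1 - c.1 := by linarith
  have hr : (p.1, a.2) ∈ convexHull ℝ {a, b, c, d} := by
    refine key (hsub (show a ∈ _ by simp)) (hsub (show b ∈ _ by simp))
      ((p.1 - a.1) / (b.1 - a.1)) (by apply div_nonneg <;> linarith)
      (by rw [div_le_one hab']; linarith) (Prod.ext ?_ ?_)
    · simp; field_simp; ring
    · simp [hab]; ring
  have hq : (p.1, z) ∈ convexHull ℝ {a, b, c, d} := by
    refine key (hsub (show c ∈ _ by simp)) (hsub (show d ∈ _ by simp))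
      ((p.1 - c.1) / (d.1 - c.1)) (by apply div_nonneg <;> linarith)
      (by rw [div_le_one hcd']; linarith) (Prod.ext ?_ ?_)
    · simp; field_simp; ring
    · simp [hz]; field_simp; ring
  have hne : z - a.2 ≠ 0 := by rcases h with h | h <;> [apply ne_of_gt; apply ne_of_lt] <;> linarith
  refine key hr hq ((p.2 - a.2) / (z - a.2)) ?_ ?_ (Prod.ext ?_ ?_)
  · rcases h with h | h
    · apply div_nonneg <;> linarith
    · apply div_nonneg_of_nonpos <;> linarith
  · rcases h with h | h
    · rw [div_le_one (by linarith)]; linarith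
    · rw [div_le_one_of_neg (by linarith)]; linarith
  · simp; ring
  · simp; field_simp; ring

/-- An affine function which vanishes at an interior point has opposite signs on the two sides, or
is zero. -/
lemma eq_of_sub_eq_mul {s u v a b c d : ℝ} (hu : u < 0) (hv : 0 < v) (h₁ : b - a = s * u)
    (h₂ : d - c = s * v) (hab : a ≤ b) (hcd : c ≤ d) : a = b ∧ c = d := by
  have hs : s ≤ 0 := nonpos_of_mul_nonneg_left (by rw [← h₁]; linarith) hu
  have hs' : 0 ≤ s := nonneg_of_mul_nonneg_left (by rw [← h₂]; linarith) hv
  obtain rfl : s = 0 := le_antisymm hs hs'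
  constructor <;> linarith

namespace PolygonDrawing

variable {n : ℕ} {up : Fin (n + 1) → Bool} (P : PolygonDrawing up)

/-- The second coordinate, at `x`, of the line through the end points of a segment. -/
noncomputable def lineAt (γ : PolygonSegment n) (x : ℝ) : ℝ :=
  (P.pt γ.1.1).2 + P.slope γ * (x - (P.pt γ.1.1).1)

variable {P}

lemma lineAt_left (γ : PolygonSegment n) : P.lineAt γ (P.pt γ.1.1).1 = (P.pt γ.1.1).2 := by
  simp [lineAt]

lemma fst_lt (γ : PolygonSegment n) : (P.pt γ.1.1).1 < (P.pt γ.1.2).1 := P.strictMono_fst γ.2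

lemma lineAt_right (γ : PolygonSegment n) : P.lineAt γ (P.pt γ.1.2).1 = (P.pt γ.1.2).2 := by
  have h := fst_lt (P := P) γ
  have h' : (P.pt γ.1.2).1 - (P.pt γ.1.1).1 ≠ 0 := by linarith
  rw [lineAt, slope, div_mul_cancel₀ _ h']
  ring

/-- A vertex weakly between the base line and a segment passing over or under it would lie in the
convex hull of other vertices. -/
lemma not_between (γ : PolygonSegment n) (m : Fin (n + 3)) (h₁ : γ.1.1 < m) (h₂ : m < γ.1.2) :
    ¬ ((P.pt 0).2 < (P.pt m).2 ∧ (P.pt m).2 ≤ P.lineAt γ (P.pt m).1 ∨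
      (P.pt m).2 < (P.pt 0).2 ∧ P.lineAt γ (P.pt m).1 ≤ (P.pt m).2) := fun h ↦ by
  have h0 : (0 : Fin (n + 3)) < m := (Fin.zero_le _).trans_lt h₁
  have hl : m < Fin.last (n + 2) := h₂.trans_le (Fin.le_last _)
  have := mem_convexHull_of_between (P.strictMono_fst h0) (P.strictMono_fst hl)
    (P.strictMono_fst h₁) (P.strictMono_fst h₂) P.snd_last h
  rw [show ({P.pt 0, P.pt (Fin.last (n + 2)), P.pt γ.1.1, P.pt γ.1.2} : Set (ℝ × ℝ)) =
    P.pt '' {0, Fin.last (n + 2), γ.1.1, γ.1.2} by simp [Set.image_insert_eq],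
    P.convexIndependent.mem_convexHull_iff] at this
  rcases this with rfl | rfl | rfl | rfl
  · exact h0.false
  · exact hl.false
  · exact h₁.false
  · exact h₂.false

lemma lineAt_lt (γ : PolygonSegment n) {m : Fin (n + 3)} (h₁ : γ.1.1 < m) (h₂ : m < γ.1.2)
    (h : UpperVertex up m) : P.lineAt γ (P.pt m).1 < (P.pt m).2 := by
  obtain ⟨a, ha, hup⟩ := h
  obtain rfl : a.castSucc.succ = m := Fin.ext (by simpa using ha)
  by_contra hle
  exact not_between γ _ h₁ h₂ (Or.inl ⟨P.above a hup, not_lt.1 hle⟩)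

lemma lt_lineAt (γ : PolygonSegment n) {m : Fin (n + 3)} (h₁ : γ.1.1 < m) (h₂ : m < γ.1.2)
    (h : ¬ UpperVertex up m) : (P.pt m).2 < P.lineAt γ (P.pt m).1 := by
  rw [Fin.lt_def] at h₁ h₂
  obtain ⟨a, rfl⟩ : ∃ a : Fin (n + 1), a.castSucc.succ = m :=
    ⟨⟨m - 1, by lia⟩, Fin.ext (by simp; lia)⟩
  have hup : up a = false := by
    by_contra hup
    exact h ⟨a, by simp, by simpa using hup⟩
  by_contra hle
  exact not_between γ _ h₁ h₂ (Or.inr ⟨P.below a hup, not_lt.1 hle⟩)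

lemma mem_openSegment_iff (γ : PolygonSegment n) (q : ℝ × ℝ) :
    q ∈ openSegment ℝ (P.pt γ.1.1) (P.pt γ.1.2) ↔
      (P.pt γ.1.1).1 < q.1 ∧ q.1 < (P.pt γ.1.2).1 ∧ q.2 = P.lineAt γ q.1 := by
  have h := fst_lt (P := P) γ
  have h' : 0 < (P.pt γ.1.2).1 - (P.pt γ.1.1).1 := by linarith
  rw [lineAt, slope]
  constructor
  · rintro ⟨a, b, ha, hb, hab, rfl⟩
    obtain rfl : a = 1 - b := by linarith
    simp only [Prod.fst_add, Prod.smul_fst, smul_eq_mul, Prod.snd_add, Prod.smul_snd]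
    refine ⟨by nlinarith, by nlinarith, ?_⟩
    field_simp
    ring
  · rintro ⟨h1, h2, h3⟩
    refine ⟨1 - (q.1 - (P.pt γ.1.1).1) / ((P.pt γ.1.2).1 - (P.pt γ.1.1).1),
      (q.1 - (P.pt γ.1.1).1) / ((P.pt γ.1.2).1 - (P.pt γ.1.1).1), ?_, ?_, by ring,
      Prod.ext ?_ ?_⟩
    · rw [sub_pos, div_lt_one h']; linarith
    · apply div_pos <;> linarith
    · simp; field_simp; ring
    · rw [h3]; simp; field_simp; ring

/-- At the left end of the common range one of the segments has its end point, and the other passes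
above or below it according to the side of that vertex. -/
lemma left_sub_pos {γ δ : PolygonSegment n} (hlt : max γ.1.1 δ.1.1 < min γ.1.2 δ.1.2)
    (h : γ.1.1 < δ.1.1 ∧ ¬ UpperVertex up δ.1.1 ∨ δ.1.1 < γ.1.1 ∧ UpperVertex up γ.1.1) :
    P.lineAt δ (P.pt (max γ.1.1 δ.1.1)).1 < P.lineAt γ (P.pt (max γ.1.1 δ.1.1)).1 := by
  obtain ⟨h1, h2⟩ := lt_min_iff.1 hlt
  rcases h with ⟨h, hU⟩ | ⟨h, hU⟩
  · rw [max_eq_right h.le] at h1 ⊢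
    rw [lineAt_left]
    exact lt_lineAt γ h h1 hU
  · rw [max_eq_left h.le] at h2 ⊢
    rw [lineAt_left]
    exact lineAt_lt δ h h2 hU

lemma right_sub_neg {γ δ : PolygonSegment n} (hlt : max γ.1.1 δ.1.1 < min γ.1.2 δ.1.2)
    (h : γ.1.2 < δ.1.2 ∧ ¬ UpperVertex up γ.1.2 ∨ δ.1.2 < γ.1.2 ∧ UpperVertex up δ.1.2) :
    P.lineAt γ (P.pt (min γ.1.2 δ.1.2)).1 < P.lineAt δ (P.pt (min γ.1.2 δ.1.2)).1 := by
  obtain ⟨h1, h2⟩ := max_lt_iff.1 hlt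
  rcases h with ⟨h, hU⟩ | ⟨h, hU⟩
  · rw [min_eq_left h.le] at h2 ⊢
    rw [lineAt_right]
    exact lt_lineAt δ h2 h hU
  · rw [min_eq_right h.le] at h1 ⊢
    rw [lineAt_right]
    exact lineAt_lt γ h1 h hU

lemma crossesUpward_iff {γ δ : PolygonSegment n} : γ.CrossesUpward up δ ↔
    max γ.1.1 δ.1.1 < min γ.1.2 δ.1.2 ∧
      (γ.1.1 < δ.1.1 ∧ ¬ UpperVertex up δ.1.1 ∨ δ.1.1 < γ.1.1 ∧ UpperVertex up γ.1.1) ∧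
      (γ.1.2 < δ.1.2 ∧ ¬ UpperVertex up γ.1.2 ∨ δ.1.2 < γ.1.2 ∧ UpperVertex up δ.1.2) := by
  rw [PolygonSegment.CrossesUpward, CrossesUpward]
  simp only [Fin.lt_def, max_lt_iff, lt_min_iff]

lemma slope_lt_of_crossesUpward {γ δ : PolygonSegment n} (h : γ.CrossesUpward up δ) :
    P.slope γ < P.slope δ := by
  obtain ⟨hlt, hl, hr⟩ := crossesUpward_iff.1 h
  have h1 := left_sub_pos (P := P) hlt hl
  have h2 := right_sub_neg (P := P) hlt hr
  have h3 := P.strictMono_fst hlt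
  simp only [lineAt] at h1 h2
  nlinarith

lemma cross_of_crossesUpward {γ δ : PolygonSegment n} (h : γ.CrossesUpward up δ) :
    P.Cross γ δ := by
  have hs := slope_lt_of_crossesUpward (P := P) h
  obtain ⟨hlt, hl, hr⟩ := crossesUpward_iff.1 h
  have h1 := left_sub_pos (P := P) hlt hl
  have h2 := right_sub_neg (P := P) hlt hr
  have hs' : 0 < P.slope δ - P.slope γ := by linarith
  refine ⟨fun h ↦ hs.ne (by rw [h]), ?_⟩
  set x₁ := (P.pt (max γ.1.1 δ.1.1)).1 with hx₁
  set x₂ := (P.pt (min γ.1.2 δ.1.2)).1 with hx₂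
  have hγ : (P.pt γ.1.1).1 ≤ x₁ := P.strictMono_fst.monotone (le_max_left _ _)
  have hδ : (P.pt δ.1.1).1 ≤ x₁ := P.strictMono_fst.monotone (le_max_right _ _)
  have hγ' : x₂ ≤ (P.pt γ.1.2).1 := P.strictMono_fst.monotone (min_le_left _ _)
  have hδ' : x₂ ≤ (P.pt δ.1.2).1 := P.strictMono_fst.monotone (min_le_right _ _)
  -- The zero of the difference of the two lines, which changes sign between `x₁` and `x₂`.
  let x := x₁ + (P.lineAt γ x₁ - P.lineAt δ x₁) / (P.slope δ - P.slope γ)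
  have hmul : (P.slope δ - P.slope γ) * (x - x₁) = P.lineAt γ x₁ - P.lineAt δ x₁ := by
    simp only [x]; field_simp; ring
  have hx1 : x₁ < x := by nlinarith
  have heq : P.lineAt γ x = P.lineAt δ x := by
    simp only [lineAt] at hmul ⊢; linarith
  have hx2 : x < x₂ := by
    simp only [lineAt] at h2 heq; nlinarith
  exact ⟨(x, P.lineAt γ x), (mem_openSegment_iff γ _).2 ⟨by linarith, by linarith, rfl⟩,
    (mem_openSegment_iff δ _).2 ⟨by linarith, by linarith, heq⟩⟩

lemma Cross.symm {γ δ : PolygonSegment n} (h : P.Cross γ δ) : P.Cross δ γ :=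
  ⟨h.1.symm, by rw [Set.inter_comm]; exact h.2⟩

lemma cross_iff {γ δ : PolygonSegment n} :
    P.Cross γ δ ↔ γ.CrossesUpward up δ ∨ δ.CrossesUpward up γ := by
  refine ⟨fun ⟨hne, q, hγ, hδ⟩ ↦ ?_, fun h ↦ h.elim cross_of_crossesUpward
    fun h ↦ (cross_of_crossesUpward h).symm⟩
  obtain ⟨h1, h2, h3⟩ := (mem_openSegment_iff γ q).1 hγ
  obtain ⟨h4, h5, h6⟩ := (mem_openSegment_iff δ q).1 hδ
  have hlt : max γ.1.1 δ.1.1 < min γ.1.2 δ.1.2 :=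
    max_lt (lt_min γ.2 (P.strictMono_fst.lt_iff_lt.1 (h1.trans h5)))
      (lt_min (P.strictMono_fst.lt_iff_lt.1 (h4.trans h2)) δ.2)
  have hlt' : max δ.1.1 γ.1.1 < min δ.1.2 γ.1.2 := by rwa [max_comm, min_comm]
  have hx1 : (P.pt (max γ.1.1 δ.1.1)).1 < q.1 := by
    rcases max_choice γ.1.1 δ.1.1 with h | h <;> rw [h] <;> assumption
  have hx2 : q.1 < (P.pt (min γ.1.2 δ.1.2)).1 := by
    rcases min_choice γ.1.2 δ.1.2 with h | h <;> rw [h] <;> assumption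
  have lp := fun h ↦ left_sub_pos (P := P) (γ := γ) (δ := δ) hlt h
  have ln := fun h ↦ left_sub_pos (P := P) (γ := δ) (δ := γ) hlt' h
  have rn := fun h ↦ right_sub_neg (P := P) (γ := γ) (δ := δ) hlt h
  have rp := fun h ↦ right_sub_neg (P := P) (γ := δ) (δ := γ) hlt' h
  rw [max_comm] at ln
  rw [min_comm] at rp
  have l0 : γ.1.1 = δ.1.1 → P.lineAt γ (P.pt (max γ.1.1 δ.1.1)).1 =
      P.lineAt δ (P.pt (max γ.1.1 δ.1.1)).1 := fun h ↦ by
    rw [← h, max_self, lineAt_left, h, lineAt_left]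
  have r0 : γ.1.2 = δ.1.2 → P.lineAt γ (P.pt (min γ.1.2 δ.1.2)).1 =
      P.lineAt δ (P.pt (min γ.1.2 δ.1.2)).1 := fun h ↦ by
    rw [← h, min_self, lineAt_right, h, lineAt_right]
  rw [crossesUpward_iff, crossesUpward_iff]
  set x₁ := (P.pt (max γ.1.1 δ.1.1)).1
  set x₂ := (P.pt (min γ.1.2 δ.1.2)).1
  have hq : P.lineAt γ q.1 = P.lineAt δ q.1 := h3.symm.trans h6
  have e : ∀ x, P.lineAt γ x - P.lineAt δ x = (P.slope γ - P.slope δ) * (x - q.1) := fun x ↦ by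
    simp only [lineAt] at hq ⊢
    linear_combination hq
  have e' : ∀ x, P.lineAt δ x - P.lineAt γ x = (P.slope δ - P.slope γ) * (x - q.1) := fun x ↦ by
    rw [← neg_sub, e]; ring
  have hpos := eq_of_sub_eq_mul (sub_neg.2 hx1) (sub_pos.2 hx2) (e x₁) (e x₂)
  have hneg := eq_of_sub_eq_mul (sub_neg.2 hx1) (sub_pos.2 hx2) (e' x₁) (e' x₂)
  -- At each end of the common range exactly one order of the two lines is dictated by the vertices,
  -- or the end points coincide. Since the lines meet strictly inside, only opposite strict orders
  -- are consistent for different segments.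
  have L : (γ.1.1 < δ.1.1 ∧ ¬ UpperVertex up δ.1.1 ∨ δ.1.1 < γ.1.1 ∧ UpperVertex up γ.1.1) ∨
      (δ.1.1 < γ.1.1 ∧ ¬ UpperVertex up γ.1.1 ∨ γ.1.1 < δ.1.1 ∧ UpperVertex up δ.1.1) ∨
      γ.1.1 = δ.1.1 := by
    clear * -
    grind
  have R : (γ.1.2 < δ.1.2 ∧ ¬ UpperVertex up γ.1.2 ∨ δ.1.2 < γ.1.2 ∧ UpperVertex up δ.1.2) ∨
      (δ.1.2 < γ.1.2 ∧ ¬ UpperVertex up δ.1.2 ∨ γ.1.2 < δ.1.2 ∧ UpperVertex up γ.1.2) ∨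
      γ.1.2 = δ.1.2 := by
    clear * -
    grind
  rcases L with hL | hL | hL <;> rcases R with hR | hR | hR
  · exact Or.inl ⟨hlt, hL, hR⟩
  · exact absurd (hpos (lp hL).le (rp hR).le).1 (lp hL).ne
  · exact absurd (hpos (lp hL).le (r0 hR).ge).1 (lp hL).ne
  · exact absurd (hneg (ln hL).le (rn hR).le).1 (ln hL).ne
  · exact Or.inr ⟨hlt', hL, hR⟩
  · exact absurd (hneg (ln hL).le (r0 hR).le).1 (ln hL).ne
  · exact absurd (hneg (l0 hL).le (rn hR).le).2 (rn hR).ne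
  · exact absurd (hpos (l0 hL).ge (rp hR).le).2 (rp hR).ne
  · exact absurd (Subtype.ext (Prod.ext hL hR)) hne

lemma noncrossing_iff {S : Set (PolygonSegment n)} : P.Noncrossing S ↔ NonCrossing up S := by
  refine ⟨fun h γ hγ δ hδ hc ↦ h γ hγ δ hδ (cross_of_crossesUpward hc), fun h γ hγ δ hδ hc ↦ ?_⟩
  exact (cross_iff.1 hc).elim (h γ hγ δ hδ) (h δ hδ γ hγ)

end PolygonDrawing

/-! ### Combinatorics of quadrilaterals and flips -/

namespace CrossesUpward

variable {U : ℕ → Prop} {i j k l a b : ℕ}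

lemma irrefl : ¬ CrossesUpward U i j i j := by
  unfold CrossesUpward; lia

lemma not_side (h : CrossesUpward U a b i j ∨ CrossesUpward U i j a b) : a ≠ i ∧ b ≠ j := by
  unfold CrossesUpward at h; lia

/-- A segment which crosses a side of the quadrilateral with two given diagonals crosses one of the
diagonals. -/
lemma crosses_of_crosses_left (h : CrossesUpward U i j k l)
    (hc : CrossesUpward U a b k j ∨ CrossesUpward U k j a b) :
    CrossesUpward U a b i j ∨ CrossesUpward U i j a b ∨ CrossesUpward U a b k l ∨
      CrossesUpward U k l a b := by
  unfold CrossesUpward at *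
  simp only [max_lt_iff, lt_min_iff] at *
  rcases h with ⟨h, h' | h', h'' | h''⟩ <;>
  rcases hc with ⟨g, g' | g', g'' | g''⟩ | ⟨g, g' | g', g'' | g''⟩ <;>
  grind (splits := 30)

lemma crosses_of_crosses_right (h : CrossesUpward U i j k l)
    (hc : CrossesUpward U a b i l ∨ CrossesUpward U i l a b) :
    CrossesUpward U a b i j ∨ CrossesUpward U i j a b ∨ CrossesUpward U a b k l ∨
      CrossesUpward U k l a b := by
  unfold CrossesUpward at *
  simp only [max_lt_iff, lt_min_iff] at *
  rcases h with ⟨h, h' | h', h'' | h''⟩ <;>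
  rcases hc with ⟨g, g' | g', g'' | g''⟩ | ⟨g, g' | g', g'' | g''⟩ <;>
  grind (splits := 30)

/-- A segment which crosses upward the diagonal of smaller slope of a quadrilateral also crosses
upward the other diagonal or one of the sides. -/
lemma trans_or_side (h : CrossesUpward U i j k l) (hc : CrossesUpward U a b i j) :
    CrossesUpward U a b k l ∨ CrossesUpward U a b k j ∨ CrossesUpward U a b i l := by
  unfold CrossesUpward at *
  grind

/-- The left condition for `(k, j)` is that for `(k, l)`, and the right condition is that for `(i,
j)`. -/
lemma side_of_pairwise (h : CrossesUpward U i j k l) (h₁ : CrossesUpward U i j a b)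
    (h₂ : CrossesUpward U k l a b) : CrossesUpward U k j a b := by
  unfold CrossesUpward at *
  grind

end CrossesUpward

section Flip

variable {n : ℕ} {up : Fin (n + 1) → Bool} {S₁ S₂ S : Set (PolygonSegment n)}
  {γ₁ γ₂ δ : PolygonSegment n}

lemma PolygonSegment.CrossesUpward.left_lt (h : γ₁.CrossesUpward up γ₂) : γ₂.1.1 < γ₁.1.2 :=
  Fin.lt_def.2 ((max_lt_iff.1 h.1).2.trans_le (min_le_left _ _))

lemma PolygonSegment.CrossesUpward.right_lt (h : γ₁.CrossesUpward up γ₂) : γ₁.1.1 < γ₂.1.2 :=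
  Fin.lt_def.2 ((max_lt_iff.1 h.1).1.trans_le (min_le_right _ _))

lemma PolygonSegment.CrossesUpward.ne (h : γ₁.CrossesUpward up γ₂) : γ₁ ≠ γ₂ := by
  rintro rfl
  exact CrossesUpward.irrefl h

lemma Maximal.mem_of_nonCrossing (hS : Maximal (NonCrossing up) S)
    (h : ∀ γ ∈ S, ¬ (γ.CrossesUpward up δ ∨ δ.CrossesUpward up γ)) : δ ∈ S := by
  refine hS.2 (y := insert δ S) ?_ (Set.subset_insert _ _) (Set.mem_insert _ _)
  rintro γ (rfl | hγ) ε (rfl | hε) hc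
  · exact CrossesUpward.irrefl hc
  · exact h ε hε (Or.inr hc)
  · exact h γ hγ (Or.inl hc)
  · exact hS.1 γ hγ ε hε hc

variable (up) in
/-- `S₂` arises from the maximal noncrossing set `S₁` by replacing `γ₁` by the segment `γ₂`, which
crosses `γ₁` and has a larger slope. -/
structure IsFlip (S₁ S₂ : Set (PolygonSegment n)) (γ₁ γ₂ : PolygonSegment n) : Prop where
  maximal_left : Maximal (NonCrossing up) S₁
  maximal_right : Maximal (NonCrossing up) S₂
  mem_left : γ₁ ∈ S₁
  mem_right : γ₂ ∈ S₂
  sdiff_eq : S₁ \ {γ₁} = S₂ \ {γ₂}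
  crossesUpward : γ₁.CrossesUpward up γ₂

/-- Otherwise `γ₂` would cross nothing in `S₁` and would belong to it by maximality. -/
lemma crossesUpward_or_of_sdiff_eq (h₁ : Maximal (NonCrossing up) S₁)
    (h₂ : Maximal (NonCrossing up) S₂) (hγ₂ : γ₂ ∈ S₂) (hne : γ₁ ≠ γ₂)
    (h : S₁ \ {γ₁} = S₂ \ {γ₂}) : γ₁.CrossesUpward up γ₂ ∨ γ₂.CrossesUpward up γ₁ := by
  by_contra hc
  have hmem : γ₂ ∈ S₁ := by
    refine h₁.mem_of_nonCrossing fun γ hγ hc' ↦ ?_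
    by_cases hγ' : γ = γ₁
    · exact hc (hγ' ▸ hc')
    · have : γ ∈ S₂ := (h.le ⟨hγ, hγ'⟩).1
      exact hc'.elim (h₂.1 γ this γ₂ hγ₂) (h₂.1 γ₂ hγ₂ γ this)
  exact (h.le ⟨hmem, hne.symm⟩).2 rfl

namespace IsFlip

lemma sdiff_subset (h : IsFlip up S₁ S₂ γ₁ γ₂) : S₁ \ {γ₁} ⊆ S₂ :=
  h.sdiff_eq ▸ Set.sdiff_subset

/-- This is the criterion for sides of the quadrilateral. A member of `S₁` other than `γ₁` also lies
in `S₂`, so it crosses neither diagonal and hence does not cross `δ`. -/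
lemma mem_sdiff_of_forall (h : IsFlip up S₁ S₂ γ₁ γ₂)
    (h₁ : ¬ (δ.CrossesUpward up γ₁ ∨ γ₁.CrossesUpward up δ)) (hne : δ ≠ γ₁)
    (hδ : ∀ ε : PolygonSegment n, ε.CrossesUpward up δ ∨ δ.CrossesUpward up ε →
      ε.CrossesUpward up γ₁ ∨ γ₁.CrossesUpward up ε ∨
        ε.CrossesUpward up γ₂ ∨ γ₂.CrossesUpward up ε) : δ ∈ S₁ \ {γ₁} := by
  refine ⟨h.maximal_left.mem_of_nonCrossing fun ε hε hc ↦ ?_, hne⟩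
  by_cases hε' : ε = γ₁
  · exact h₁ (hε' ▸ hc.symm)
  have hε₂ : ε ∈ S₂ := h.sdiff_subset ⟨hε, hε'⟩
  rcases hδ ε hc with hc | hc | hc | hc
  · exact h.maximal_left.1 _ hε _ h.mem_left hc
  · exact h.maximal_left.1 _ h.mem_left _ hε hc
  · exact h.maximal_right.1 _ hε₂ _ h.mem_right hc
  · exact h.maximal_right.1 _ h.mem_right _ hε₂ hc

lemma fst_ne (h : γ₁.CrossesUpward up γ₂) : γ₁.1.1 ≠ γ₂.1.1 :=
  fun e ↦ (CrossesUpward.not_side (Or.inl h)).1 (congrArg Fin.val e)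

lemma snd_ne (h : γ₁.CrossesUpward up γ₂) : γ₁.1.2 ≠ γ₂.1.2 :=
  fun e ↦ (CrossesUpward.not_side (Or.inl h)).2 (congrArg Fin.val e)

lemma left_side_mem (h : IsFlip up S₁ S₂ γ₁ γ₂) :
    (⟨(γ₂.1.1, γ₁.1.2), h.crossesUpward.left_lt⟩ : PolygonSegment n) ∈ S₁ \ {γ₁} :=
  h.mem_sdiff_of_forall (fun hc ↦ (CrossesUpward.not_side hc).2 rfl)
    (fun e ↦ fst_ne h.crossesUpward (congrArg (fun σ : PolygonSegment n ↦ σ.1.1) e).symm)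
    fun _ hc ↦ CrossesUpward.crosses_of_crosses_left h.crossesUpward hc

lemma right_side_mem (h : IsFlip up S₁ S₂ γ₁ γ₂) :
    (⟨(γ₁.1.1, γ₂.1.2), h.crossesUpward.right_lt⟩ : PolygonSegment n) ∈ S₁ \ {γ₁} :=
  h.mem_sdiff_of_forall (fun hc ↦ (CrossesUpward.not_side hc).1 rfl)
    (fun e ↦ snd_ne h.crossesUpward (congrArg (fun σ : PolygonSegment n ↦ σ.1.2) e).symm)
    fun _ hc ↦ CrossesUpward.crosses_of_crosses_right h.crossesUpward hc

lemma ne (h : IsFlip up S₁ S₂ γ₁ γ₂) : S₁ ≠ S₂ := by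
  rintro rfl
  exact h.maximal_left.1 _ h.mem_left _ h.mem_right h.crossesUpward

/-- A flip does not destroy upward crossings. -/
lemma exists_crossesUpward (h : IsFlip up S₁ S₂ γ₁ γ₂) (hδ : ∃ γ ∈ S₁, δ.CrossesUpward up γ) :
    ∃ γ ∈ S₂, δ.CrossesUpward up γ := by
  obtain ⟨γ, hγ, hc⟩ := hδ
  by_cases hγ' : γ = γ₁
  · subst hγ'
    rcases CrossesUpward.trans_or_side h.crossesUpward hc with hc | hc | hc
    · exact ⟨_, h.mem_right, hc⟩
    · exact ⟨_, h.sdiff_subset h.left_side_mem, hc⟩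
    · exact ⟨_, h.sdiff_subset h.right_side_mem, hc⟩
  · exact ⟨γ, h.sdiff_subset ⟨hγ, hγ'⟩, hc⟩

lemma mem_or_exists_crossesUpward (h : IsFlip up S₁ S₂ γ₁ γ₂) (hδ : δ ∈ S₁) :
    δ ∈ S₂ ∨ ∃ γ ∈ S₂, δ.CrossesUpward up γ := by
  by_cases hδ' : δ = γ₁
  · exact Or.inr ⟨γ₂, h.mem_right, hδ' ▸ h.crossesUpward⟩
  · exact Or.inl (h.sdiff_subset ⟨hδ, hδ'⟩)

/-- The result of a flip is determined by the segment which is removed. -/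
lemma eq_of_left_eq {S₂' : Set (PolygonSegment n)} {γ₂' : PolygonSegment n}
    (h : IsFlip up S₁ S₂ γ₁ γ₂) (h' : IsFlip up S₁ S₂' γ₁ γ₂') : S₂' = S₂ := by
  have hS : S₂ \ {γ₂} = S₂' \ {γ₂'} := h.sdiff_eq.symm.trans h'.sdiff_eq
  obtain rfl : γ₂ = γ₂' := by
    by_contra hne
    -- Two different replacements would cross each other. Then a side of one quadrilateral, which
    -- lies in both results, would cross the replacement in the other.
    rcases crossesUpward_or_of_sdiff_eq h.maximal_right h'.maximal_right h'.mem_right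
      hne hS with hc | hc
    · exact h'.maximal_right.1 _ (h'.sdiff_subset h.left_side_mem) _ h'.mem_right
        (CrossesUpward.side_of_pairwise h.crossesUpward h'.crossesUpward hc)
    · exact h.maximal_right.1 _ (h.sdiff_subset h'.left_side_mem) _ h.mem_right
        (CrossesUpward.side_of_pairwise h'.crossesUpward h.crossesUpward hc)
  rw [← Set.insert_sdiff_self_of_mem h'.mem_right, ← hS, Set.insert_sdiff_self_of_mem h.mem_right]

end IsFlip

end Flip

/-! ### The order on triangulations -/

namespace PolygonDrawing.Triangulation

variable {n : ℕ} {up : Fin (n + 1) → Bool} {P : PolygonDrawing up} {T₁ T₂ T : P.Triangulation}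

lemma maximal_iff {S : Set (PolygonSegment n)} :
    Maximal P.Noncrossing S ↔ Maximal (NonCrossing up) S := by
  rw [show P.Noncrossing = NonCrossing up from funext fun _ ↦ propext noncrossing_iff]

lemma coveredBy_iff : CoveredBy T₁ T₂ ↔ ∃ γ₁ γ₂, IsFlip up T₁.1 T₂.1 γ₁ γ₂ := by
  constructor
  · rintro ⟨γ₁, h₁, γ₂, h₂, hne, h, hs⟩
    have hm₁ := maximal_iff.1 T₁.2
    have hm₂ := maximal_iff.1 T₂.2
    refine ⟨γ₁, γ₂, hm₁, hm₂, h₁, h₂, h, ?_⟩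
    exact (crossesUpward_or_of_sdiff_eq hm₁ hm₂ h₂ hne h).resolve_right fun hc ↦
      hs.not_gt (slope_lt_of_crossesUpward hc)
  · rintro ⟨γ₁, γ₂, h⟩
    exact ⟨γ₁, h.mem_left, γ₂, h.mem_right, h.crossesUpward.ne, h.sdiff_eq,
      slope_lt_of_crossesUpward h.crossesUpward⟩

lemma exists_crossesUpward_of_le {δ : PolygonSegment n} (h : T₁ ≤ T₂)
    (hδ : ∃ γ ∈ T₁.1, δ.CrossesUpward up γ) : ∃ γ ∈ T₂.1, δ.CrossesUpward up γ := by
  induction h with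
  | refl => exact hδ
  | tail _ h ih =>
    obtain ⟨γ₁, γ₂, h⟩ := coveredBy_iff.1 h
    exact h.exists_crossesUpward ih

lemma mem_or_exists_crossesUpward_of_le {δ : PolygonSegment n} (h : T₁ ≤ T₂) (hδ : δ ∈ T₁.1) :
    δ ∈ T₂.1 ∨ ∃ γ ∈ T₂.1, δ.CrossesUpward up γ := by
  induction h with
  | refl => exact Or.inl hδ
  | tail _ h ih =>
    obtain ⟨γ₁, γ₂, h⟩ := coveredBy_iff.1 h
    exact ih.elim h.mem_or_exists_crossesUpward fun ih ↦ Or.inr (h.exists_crossesUpward ih)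

/-- A segment which belongs to both ends of an interval belongs to all its members. -/
lemma mem_of_le_of_le {δ : PolygonSegment n} (h₁ : T₁ ≤ T) (h₂ : T ≤ T₂) (hδ₁ : δ ∈ T₁.1)
    (hδ₂ : δ ∈ T₂.1) : δ ∈ T.1 := by
  refine (mem_or_exists_crossesUpward_of_le h₁ hδ₁).resolve_right fun h ↦ ?_
  obtain ⟨γ, hγ, hc⟩ := exists_crossesUpward_of_le h₂ h
  exact (maximal_iff.1 T₂.2).1 _ hδ₂ _ hγ hc

lemma le_antisymm (h₁ : T₁ ≤ T₂) (h₂ : T₂ ≤ T₁) : T₁ = T₂ := by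
  have h : T₁.1 ⊆ T₂.1 := fun δ hδ ↦ mem_of_le_of_le h₁ h₂ hδ hδ
  exact Subtype.ext (h.antisymm (T₁.2.2 T₂.2.1 h))

lemma covBy_of_coveredBy (h : CoveredBy T₁ T₂) : T₁ ⋖ T₂ := by
  obtain ⟨γ₁, γ₂, hf⟩ := coveredBy_iff.1 h
  have hle : T₁ ≤ T₂ := Relation.ReflTransGen.single h
  refine ⟨lt_of_le_not_ge hle fun h' ↦ hf.ne (congrArg Subtype.val (le_antisymm hle h')),
    fun T hT₁ hT₂ ↦ ?_⟩
  rcases Relation.ReflTransGen.cases_head hT₁.le with rfl | ⟨T', hT', hTT⟩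
  · exact hT₁.false
  obtain ⟨γ, γ', hf'⟩ := coveredBy_iff.1 hT'
  -- If the first flip of a chain from `T₁` through `T` removed a segment other than `γ₁`, that
  -- segment would lie in `T₁` and in `T₂`, hence also in `T'`, where it crosses `γ'`.
  have hγ : γ = γ₁ := by
    by_contra hne
    have hmem : γ ∈ T'.1 := mem_of_le_of_le (Relation.ReflTransGen.single hT')
      (le_trans (b := T) hTT hT₂.le) hf'.mem_left (hf.sdiff_subset ⟨hf'.mem_left, hne⟩)
    exact hf'.maximal_right.1 _ hmem _ hf'.mem_right hf'.crossesUpward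
  subst hγ
  obtain rfl : T' = T₂ := Subtype.ext (hf.eq_of_left_eq hf')
  exact hT₂.not_ge hTT

end PolygonDrawing.Triangulation

/-- A cover of an order generated by a relation is an instance of the relation. -/
lemma CovBy.of_le_eq_reflTransGen {α : Type*} [Preorder α] {r : α → α → Prop}
    (hle : ∀ a b : α, a ≤ b ↔ Relation.ReflTransGen r a b) (hr : ∀ a b, r a b → a < b) {a b : α}
    (h : a ⋖ b) : r a b := by
  rcases Relation.ReflTransGen.cases_head ((hle a b).1 h.le) with rfl | ⟨c, hac, hcb⟩
  · exact absurd h.lt (lt_irrefl _)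
  rcases Relation.ReflTransGen.cases_tail hcb with rfl | ⟨d, hcd, hdb⟩
  · exact hac
  · exact absurd (((hle c d).2 hcd).trans_lt (hr d b hdb)) (h.2 (hr a c hac))

/-! ### Covers of maximal almost rigid representations are flips -/

namespace TypeARep

variable {k : Type u} [Field k] {n : ℕ} {up : Fin (n + 1) → Bool} {T₁ T₂ : TypeARep k up}

/-- The non-split sequence orients the crossing. In the other direction `Ext¹(M₂, M₁)` would vanish,
since crossing segments do not meet end to end. -/
lemma crossesUpward_of_shortExact {γ₁ γ₂ : PolygonSegment n} {M₁ M₂ E : TypeARep k up}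
    (e₁ : M₁ ≅ segmentRep k up γ₁) (e₂ : M₂ ≅ segmentRep k up γ₂)
    (hc : γ₁.CrossesUpward up γ₂ ∨ γ₂.CrossesUpward up γ₁) {f : M₁ ⟶ E} {g : E ⟶ M₂}
    {w : f ≫ g = 0} (hS : (ShortComplex.mk f g w).ShortExact)
    (hsplit : IsEmpty (ShortComplex.mk f g w).Splitting) : γ₁.CrossesUpward up γ₂ := by
  by_contra h
  have hlt : γ₂.1.1 < γ₁.1.2 ∧ γ₁.1.1 < γ₂.1.2 :=
    hc.elim (fun h ↦ ⟨h.left_lt, h.right_lt⟩) fun h ↦ ⟨h.right_lt, h.left_lt⟩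
  have := subsingleton_ext_segmentRep (k := k) h (fun h' ↦ hlt.2.ne h'.1) fun h' ↦ hlt.1.ne h'.1
  have := Abelian.Ext.subsingleton_of_iso e₂ e₁ 1
  exact hsplit.elim
    (Abelian.Ext.nonempty_splitting_of_extClass_eq_zero hS (Subsingleton.elim _ _)).some

lemma segments_eq_insert {T M R : TypeARep k up} (hT : IsBasic T) (e : T ≅ M ⊞ R)
    {γ : PolygonSegment n} (e' : M ≅ segmentRep k up γ) :
    γ ∈ segments T ∧ segments T \ {γ} = segments R := by
  have hM : segments M = {γ} := by rw [segments_of_iso e', segments_segmentRep]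
  have hγ : γ ∉ segments R :=
    (hT.of_isSummand (IsSummand.of_iso e.symm)).notMem_segments (by rw [hM]; rfl)
  rw [segments_of_iso e, segments_biprod, hM, Set.singleton_union]
  exact ⟨Set.mem_insert _ _, Set.insert_sdiff_self_of_notMem hγ⟩

lemma coveredBy_iff (h₁ : IsMaximalAlmostRigid T₁) (h₂ : IsMaximalAlmostRigid T₂) :
    CoveredBy T₁ T₂ ↔ ∃ γ₁ γ₂, IsFlip up (segments T₁) (segments T₂) γ₁ γ₂ := by
  obtain ⟨hb₁, hm₁⟩ := isMaximalAlmostRigid_iff.1 h₁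
  obtain ⟨hb₂, hm₂⟩ := isMaximalAlmostRigid_iff.1 h₂
  constructor
  · rintro ⟨M₁, M₂, R, E, E', hM₁, hM₂, ⟨e₁⟩, ⟨e₂⟩, -, -, -, -, f, g, w, hS, hsplit⟩
    obtain ⟨γ₁, ⟨i₁⟩⟩ := exists_iso_segmentRep hM₁
    obtain ⟨γ₂, ⟨i₂⟩⟩ := exists_iso_segmentRep hM₂
    obtain ⟨hγ₁, hR₁⟩ := segments_eq_insert hb₁ e₁ i₁
    obtain ⟨hγ₂, hR₂⟩ := segments_eq_insert hb₂ e₂ i₂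
    have hne : γ₁ ≠ γ₂ := by
      rintro rfl
      have := subsingleton_ext_segmentRep (k := k) (up := up) (γ := γ₁) (δ := γ₁)
        CrossesUpward.irrefl (fun h ↦ γ₁.2.ne h.1) fun h ↦ γ₁.2.ne h.1
      have := Abelian.Ext.subsingleton_of_iso i₂ i₁ 1
      exact hsplit.elim
        (Abelian.Ext.nonempty_splitting_of_extClass_eq_zero hS (Subsingleton.elim _ _)).some
    have h := hR₁.trans hR₂.symm
    exact ⟨γ₁, γ₂, hm₁, hm₂, hγ₁, hγ₂, h, crossesUpward_of_shortExact i₁ i₂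
      (crossesUpward_or_of_sdiff_eq hm₁ hm₂ hγ₂ hne h) hS hsplit⟩
  · rintro ⟨γ₁, γ₂, h⟩
    obtain ⟨R, ⟨e₁⟩, hbR, hR⟩ := exists_iso_biprod_of_mem_segments hb₁ h.mem_left
    obtain ⟨R', ⟨e₂⟩, hbR', hR'⟩ := exists_iso_biprod_of_mem_segments hb₂ h.mem_right
    obtain ⟨e⟩ := nonempty_iso_of_segments_eq hbR' hbR (by rw [hR, hR', h.sdiff_eq])
    exact ⟨_, _, R, _, _, indecomposable_segmentRep γ₁, indecomposable_segmentRep γ₂, ⟨e₁⟩,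
      ⟨e₂ ≪≫ biprod.mapIso (Iso.refl _) e⟩, indecomposable_segmentRep _,
      indecomposable_segmentRep _, hR.ge h.left_side_mem, hR.ge h.right_side_mem,
      exists_shortExact_of_crossesUpward h.crossesUpward _ _⟩

end TypeARep

/-! ### The isomorphism with the Cambrian lattice -/

namespace Mar

variable {k : Type u} [Field k] {n : ℕ} {up : Fin (n + 1) → Bool}

open PolygonDrawing

/-- The triangulation which consists of the line segments of the indecomposable summands of a
maximal almost rigid representation. -/
def triangulation (P : PolygonDrawing up) : Mar k up → P.Triangulation :=
  Quotient.lift (fun T ↦ ⟨TypeARep.segments T.1,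
    Triangulation.maximal_iff.2 (TypeARep.isMaximalAlmostRigid_iff.1 T.2).2⟩)
    fun _ _ ⟨e⟩ ↦ Subtype.ext (TypeARep.segments_of_iso e)

lemma exists_eq_mk (t : Mar k up) : ∃ T hT, t = mk T hT := by
  obtain ⟨⟨T, hT⟩, rfl⟩ := Quotient.exists_rep t
  exact ⟨T, hT, rfl⟩

lemma triangulation_bijective (P : PolygonDrawing up) :
    Function.Bijective (triangulation P : Mar k up → P.Triangulation) := by
  constructor
  · intro t₁ t₂ h
    obtain ⟨T₁, h₁, rfl⟩ := exists_eq_mk t₁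
    obtain ⟨T₂, h₂, rfl⟩ := exists_eq_mk t₂
    exact Quotient.sound (TypeARep.nonempty_iso_of_segments_eq
      (TypeARep.isMaximalAlmostRigid_iff.1 h₁).1 (TypeARep.isMaximalAlmostRigid_iff.1 h₂).1
      (congrArg Subtype.val h))
  · rintro ⟨S, hS⟩
    obtain ⟨T, hb, rfl⟩ := TypeARep.exists_isBasic_segments_eq k up S
    exact ⟨mk T (TypeARep.isMaximalAlmostRigid_iff.2 ⟨hb, Triangulation.maximal_iff.1 hS⟩), rfl⟩

lemma coveredBy_triangulation_iff (P : PolygonDrawing up) {t₁ t₂ : Mar k up} :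
    (triangulation P t₁).CoveredBy (triangulation P t₂) ↔ CoveredBy t₁ t₂ := by
  rw [Triangulation.coveredBy_iff]
  constructor
  · intro h
    obtain ⟨T₁, h₁, rfl⟩ := exists_eq_mk t₁
    obtain ⟨T₂, h₂, rfl⟩ := exists_eq_mk t₂
    exact ⟨T₁, T₂, h₁, h₂, rfl, rfl, (TypeARep.coveredBy_iff h₁ h₂).2 h⟩
  · rintro ⟨T₁, T₂, h₁, h₂, rfl, rfl, h⟩
    exact (TypeARep.coveredBy_iff h₁ h₂).1 h

/-- The isomorphism of `mar(Q)` with the Cambrian lattice. -/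
noncomputable def triangulationOrderIso (P : PolygonDrawing up) : Mar k up ≃o P.Triangulation where
  toEquiv := Equiv.ofBijective _ (triangulation_bijective P)
  map_rel_iff' {t₁ t₂} := by
    let e := Equiv.ofBijective (triangulation (k := k) P) (triangulation_bijective P)
    have he : ∀ a b, (e a).CoveredBy (e b) ↔ CoveredBy a b :=
      fun _ _ ↦ coveredBy_triangulation_iff P
    refine ⟨fun h ↦ ?_, fun h ↦ ?_⟩
    · have := Relation.ReflTransGen.lift (p := CoveredBy) e.symm
        (fun a b hab ↦ (he _ _).1 (by simpa using hab)) (e t₁) (e t₂) h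
      rwa [Function.onFun, Equiv.symm_apply_apply, Equiv.symm_apply_apply] at this
    · exact Relation.ReflTransGen.lift e (fun a b ↦ (he a b).2) t₁ t₂ h

lemma coveredBy_triangulationOrderIso_iff (P : PolygonDrawing up) {t₁ t₂ : Mar k up} :
    (triangulationOrderIso P t₁).CoveredBy (triangulationOrderIso P t₂) ↔ CoveredBy t₁ t₂ :=
  coveredBy_triangulation_iff P

end Mar

theorem theorem4 (k : Type u) [Field k] (n : ℕ) (up : Fin (n + 1) → Bool)
    (P : PolygonDrawing up) :
    (∀ t₁ t₂ : Mar k up, t₁ ≤ t₂ → t₂ ≤ t₁ → t₁ = t₂) ∧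
    (∀ t₁ t₂ : Mar k up, t₁ ⋖ t₂ ↔ Mar.CoveredBy t₁ t₂) ∧
    Nonempty (Mar k up ≃o P.Triangulation) := by
  let Φ : Mar k up ≃o P.Triangulation := Mar.triangulationOrderIso P
  have hcov : ∀ t₁ t₂ : Mar k up, Mar.CoveredBy t₁ t₂ → t₁ ⋖ t₂ := fun t₁ t₂ h ↦
    (apply_covBy_apply_iff Φ).1 <| PolygonDrawing.Triangulation.covBy_of_coveredBy
      ((Mar.coveredBy_triangulationOrderIso_iff P).2 h)
  refine ⟨fun t₁ t₂ h h' ↦ Φ.injective ?_, fun t₁ t₂ ↦ ⟨fun h ↦ ?_, hcov t₁ t₂⟩, ⟨Φ⟩⟩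
  · exact PolygonDrawing.Triangulation.le_antisymm (Φ.map_rel_iff.2 h) (Φ.map_rel_iff.2 h')
  · exact CovBy.of_le_eq_reflTransGen (fun _ _ ↦ Iff.rfl) (fun a b h ↦ (hcov a b h).lt) h
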